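/- Let $X$ be a locally finite, pure $n$-dimensional (abstract) simplicial complex, i.e. every simplex of $X$ is contained in an $n$-simplex and every vertex lies in finitely many $n$-simplices. Write $X(j)$ for the set of $j$-simplices, and for $\tau\in X(j)$, $0\le j\le n$, put $m(\tau)=(n-j)!\,|\{\sigma\in X(n):\tau\subseteq\sigma\}|$. Let $\Gamma$ be a locally compact (Hausdorff) unimodular group acting on $X$ by simplicial automorphisms, properly (vertex stabilizers are compact and open) and cocompactly (finitely many orbits of simplices). For $\tau\in X(k-1)$ with $1\le k\le n-1$, let $X_\tau=\{\eta\in X:\tau\cap\eta=\emptyset,\ \tau\cup\eta\in X\}$ be the link of $\tau$ and $(V_\tau,E_\tau)$ its $1$-skeleton, a finite graph with edge weights $m_\tau(\{u,v\})=m(\tau\cup\{u,v\})$, vertex weights $m_\tau(v)=\sum_{\{u,v\}\in E_\tau}m_\tau(\{u,v\})$ and $m_\tau(\emptyset)=\sum_{v\in V_\tau}m_\tau(v)$. For scalar functions $\phi$ on $V_\tau$ let $$(A_\tau\phi)(v)=\sum_{u:\{u,v\}\in E_\tau}\frac{m_\tau(\{u,v\})}{m_\tau(v)}\phi(u),\qquad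 M_\tau\phi\equiv\frac1{m_\tau(\emptyset)}\sum_{v\in V_\tau}m_\tau(v)\phi(v).$$ For a (real or complex) Banach space $\mathbb E$, let $\ell^2(V_\tau,m_\tau;\mathbb E)$ be the space of functions $\phi:V_\tau\to\mathbb E$ with norm $\left(\sum_v m_\tau(v)|\phi(v)|^2\right)^{1/2}$; for an operator $(T\phi)(v)=\sum_u T_{v,u}\phi(u)$ on scalar functions let $T\otimes\mathrm{id}_{\mathbb E}$ be the operator on $\ell^2(V_\tau,m_\tau;\mathbb E)$ given by the same formula. Let $\pi$ be an isometric linear representation of $\Gamma$ on $\mathbb E$, continuous in the strong operator topology. Let $\Sigma(k)$ be the set of ordered $k$-simplices ($(k+1)$-tuples of distinct vertices spanning a simplex), let $C^k(X,\pi)$ be the space of maps $\phi:\Sigma(k)\to\mathbb E$ that are alternating, $\phi(v_{\gamma(0)},\dots,v_{\gamma(k)})=\operatorname{sgn}(\gamma)\phi(v_0,\dots,v_k)$ for every permutation $\gamma$ of $\{0,\dots,k\}$, and equivariant, $\phi(g\sigma)=\pi(g)\phi(\sigma)$ for every $g\in\Gamma$, let $d_k:C^k(X,\pi)\to C^{k+1}(X,\pi)$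 be $d_k\phi(v_0,\dots,v_{k+1})=\sum_{i=0}^{k+1}(-1)^i\phi(v_0,\dots,\widehat{v_i},\dots,v_{k+1})$, and let $H^k(X,\pi)=\operatorname{Ker}(d_k)/\operatorname{Im}(d_{k-1})$. **Theorem.** Let $X$ and $\Gamma$ be as above, let $\mathbb E$ be a reflexive Banach space and let $1\le k\le n-1$. If $$\left\|\left(A_\tau(I-M_\tau)\right)\otimes\mathrm{id}_{\mathbb E}\right\|_{B(\ell^2(V_\tau,m_\tau;\mathbb E))}<\frac1{k+1}\qquad\text{for every }\tau\in X(k-1),$$ then $H^k(X,\pi)=0$ for every continuous isometric representation $\pi$ of $\Gamma$ on $\mathbb E$. -/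

import Mathlib

noncomputable section

namespace GarlandBanach

/-! ### Operators on vector valued `ℓ²` spaces over a finite set -/

section VectorValued

variable {W : Type*} [Fintype W]

/-- The norm of `ℓ²(W, m; E)`: `‖φ‖ = (∑ v, m(v) |φ(v)|²)^{1/2}`. -/
def l2Norm {E : Type*} [NormedAddCommGroup E] (m : W → ℝ) (φ : W → E) : ℝ :=
  Real.sqrt (∑ v, m v * ‖φ v‖ ^ 2)

/-- The operator norm of a linear operator on `ℓ²(W, m; E)`. -/
def l2OpNorm (𝕜 : Type*) [RCLike 𝕜] {E : Type*} [NormedAddCommGroup E] [NormedSpace 𝕜 E]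
    (m : W → ℝ) (T : (W → E) →ₗ[𝕜] (W → E)) : ℝ :=
  sInf {C : ℝ | 0 ≤ C ∧ ∀ φ : W → E, l2Norm m (T φ) ≤ C * l2Norm m φ}

/-- `T ⊗ id_E`: if `(T φ)(v) = ∑ u, T_{v,u} φ(u)` for scalar functions `φ`, then
`((T ⊗ id_E) φ)(v) = ∑ u, T_{v,u} φ(u)` for `E`-valued functions `φ`.
The matrix coefficient `T_{v,u}` is `T δ_u` evaluated at `v`. -/
def tensorId {𝕜 : Type*} [RCLike 𝕜] [DecidableEq W] (T : (W → 𝕜) →ₗ[𝕜] (W → 𝕜))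
    (E : Type*) [NormedAddCommGroup E] [NormedSpace 𝕜 E] : (W → E) →ₗ[𝕜] (W → E) where
  toFun φ v := ∑ u, T (Pi.single u 1) v • φ u
  map_add' φ ψ := by
    funext v
    simp only [Pi.add_apply, smul_add, Finset.sum_add_distrib]
  map_smul' c φ := by
    funext v
    simp only [Pi.smul_apply, RingHom.id_apply, Finset.smul_sum]
    exact Finset.sum_congr rfl fun u _ => smul_comm _ _ _

end VectorValued

/-! ### Random walks on finite weighted graphs -/

section WeightedGraph

variable {W : Type*} [Fintype W] (G : SimpleGraph W) (m : Sym2 W → ℝ)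

open Classical in
/-- The weight of a vertex: the sum of the weights of the edges `{v, u}` containing it. -/
def vertexWeight (v : W) : ℝ := ∑ u with G.Adj v u, m s(v, u)

/-- `m(∅)`: the sum of the weights of all vertices. -/
def totalWeight : ℝ := ∑ v, vertexWeight G m v

open Classical in
/-- The random walk operator `(A φ)(v) = ∑_{u ∼ v} (m({v,u}) / m(v)) φ(u)`. -/
def randomWalk (𝕜 : Type*) [RCLike 𝕜] : (W → 𝕜) →ₗ[𝕜] (W → 𝕜) where
  toFun φ v := ∑ u with G.Adj v u, ((m s(v, u) / vertexWeight G m v : ℝ) : 𝕜) * φ u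
  map_add' φ ψ := by
    funext v
    simp only [Pi.add_apply, mul_add, Finset.sum_add_distrib]
  map_smul' c φ := by
    funext v
    simp only [Pi.smul_apply, smul_eq_mul, RingHom.id_apply, Finset.mul_sum]
    exact Finset.sum_congr rfl fun u _ => mul_left_comm _ _ _

/-- The orthogonal projection of `ℓ²(W, m)` on the constant functions:
`M φ ≡ (1 / m(∅)) ∑ v, m(v) φ(v)`. -/
def constProjection (𝕜 : Type*) [RCLike 𝕜] : (W → 𝕜) →ₗ[𝕜] (W → 𝕜) where
  toFun φ _ := ((1 / totalWeight G m : ℝ) : 𝕜) * ∑ v, (vertexWeight G m v : 𝕜) * φ v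
  map_add' φ ψ := by
    funext v
    simp only [Pi.add_apply, mul_add, Finset.sum_add_distrib]
  map_smul' c φ := by
    funext v
    simp only [Pi.smul_apply, smul_eq_mul, RingHom.id_apply, Finset.mul_sum]
    exact Finset.sum_congr rfl fun u _ => by ring

end WeightedGraph

/-! ### Weighted simplicial complexes, links -/

/-- A locally finite, pure `n`-dimensional simplicial complex with vertex set `V`.
A face of dimension `k` is a face with `k + 1` vertices. -/
structure PureComplex (V : Type*) (n : ℕ) extends AbstractSimplicialComplex V where
  /-- every face is contained in an `n`-dimensional face -/
  pure : ∀ σ ∈ faces, ∃ ρ ∈ faces, σ ⊆ ρ ∧ ρ.card = n + 1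
  /-- every vertex lies in finitely many `n`-dimensional faces -/
  locallyFinite : ∀ v : V, {ρ : Finset V | ρ ∈ faces ∧ ρ.card = n + 1 ∧ v ∈ ρ}.Finite

namespace PureComplex

variable {V : Type*} [DecidableEq V] {n : ℕ} (X : PureComplex V n)

/-- The weight `m(τ) = (n - k)! · #{σ ∈ X(n) : τ ⊆ σ}` of a `k`-dimensional face `τ`. -/
def weight (τ : Finset V) : ℝ :=
  ((n + 1 - τ.card).factorial : ℝ) *
    ({σ : Finset V | σ ∈ X.faces ∧ σ.card = n + 1 ∧ τ ⊆ σ}.ncard : ℝ)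

/-- The link of a face `τ`: the faces `η` with `τ ∩ η = ∅` and `τ ∪ η ∈ X`. -/
def link (τ : X.faces) : PreAbstractSimplicialComplex V where
  faces := {η : Finset V | η.Nonempty ∧ Disjoint τ.1 η ∧ τ.1 ∪ η ∈ X.faces}
  isRelLowerSet_faces := by
    rintro η ⟨hne, hdisj, hmem⟩
    refine ⟨hne, fun ξ hξ hξne => ⟨hξne, hdisj.mono_right hξ, ?_⟩⟩
    exact (X.isRelLowerSet_faces hmem).2 (Finset.union_subset_union_right hξ)
      (hξne.mono Finset.subset_union_right)

/-- The vertex set `V_τ` of the link of `τ`. -/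
def LinkVertex (τ : X.faces) : Type _ := {v : V // {v} ∈ (X.link τ).faces}

instance (τ : X.faces) : DecidableEq (X.LinkVertex τ) :=
  inferInstanceAs (DecidableEq {v : V // {v} ∈ (X.link τ).faces})

instance (τ : X.faces) : Finite (X.LinkVertex τ) := by
  obtain ⟨w, hw⟩ := (X.isRelLowerSet_faces τ.2).1
  have hfin : (⋃ ρ ∈ {ρ : Finset V | ρ ∈ X.faces ∧ ρ.card = n + 1 ∧ w ∈ ρ},
      (ρ : Set V)).Finite :=
    (X.locallyFinite w).biUnion fun ρ _ => ρ.finite_toSet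
  have hsub : {v : V | ({v} : Finset V) ∈ (X.link τ).faces} ⊆
      ⋃ ρ ∈ {ρ : Finset V | ρ ∈ X.faces ∧ ρ.card = n + 1 ∧ w ∈ ρ}, (ρ : Set V) := ?_
  · exact (hfin.subset hsub).to_subtype
  rintro v ⟨-, -, hv⟩
  obtain ⟨ρ, hρ, hsub, hcard⟩ := X.pure _ hv
  refine Set.mem_biUnion (x := ρ) ⟨hρ, hcard, hsub (Finset.mem_union_left _ hw)⟩ ?_
  exact hsub (Finset.mem_union_right _ (Finset.mem_singleton_self v))

instance (τ : X.faces) : Fintype (X.LinkVertex τ) := Fintype.ofFinite _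

/-- The `1`-skeleton `(V_τ, E_τ)` of the link of `τ`. -/
def linkGraph (τ : X.faces) : SimpleGraph (X.LinkVertex τ) where
  Adj u v := u ≠ v ∧ ({u.1, v.1} : Finset V) ∈ (X.link τ).faces
  symm := ⟨fun u v h => ⟨h.1.symm, by rw [Finset.pair_comm]; exact h.2⟩⟩
  loopless := ⟨fun _ h => h.1 rfl⟩

/-- The weight `m_τ({u, v}) = m(τ ∪ {u, v})` of an edge of the `1`-skeleton of the link. -/
def linkWeight (τ : X.faces) (e : Sym2 (X.LinkVertex τ)) : ℝ :=
  X.weight (τ.1 ∪ (e.map Subtype.val).toFinset)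

/-- The norm of `A_τ (I - M_τ) ⊗ id_E` on `ℓ²(V_τ, m_τ; E)`, where `A_τ` is the random walk
operator on the `1`-skeleton of the link of `τ` and `M_τ` is the orthogonal projection of
`ℓ²(V_τ, m_τ)` on the constant functions. -/
def linkNorm (𝕜 : Type*) [RCLike 𝕜] (E : Type*) [NormedAddCommGroup E] [NormedSpace 𝕜 E]
    (τ : X.faces) : ℝ :=
  l2OpNorm 𝕜 (vertexWeight (X.linkGraph τ) (X.linkWeight τ))
    (tensorId
      (randomWalk (X.linkGraph τ) (X.linkWeight τ) 𝕜 ∘ₗ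
        (LinearMap.id - constProjection (X.linkGraph τ) (X.linkWeight τ) 𝕜)) E)

/-- The set `Σ(k)` of ordered `k`-simplices: `(k+1)`-tuples of distinct vertices spanning a
face. -/
def OrderedSimplex (k : ℕ) : Type _ :=
  {s : Fin (k + 1) → V // Function.Injective s ∧ Finset.univ.image s ∈ X.faces}

namespace OrderedSimplex

variable {X} {k : ℕ}

/-- The ordered simplex `(v_{γ(0)}, …, v_{γ(k)})`. -/
def perm (s : X.OrderedSimplex k) (γ : Equiv.Perm (Fin (k + 1))) : X.OrderedSimplex k :=
  ⟨s.1 ∘ γ, s.2.1.comp γ.injective, by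
    rw [← Finset.image_image, Finset.image_univ_equiv]
    exact s.2.2⟩

/-- The ordered simplex `(v_0, …, v̂_i, …, v_{k+1})`. -/
def face (s : X.OrderedSimplex (k + 1)) (i : Fin (k + 2)) : X.OrderedSimplex k :=
  ⟨s.1 ∘ i.succAbove, s.2.1.comp Fin.succAbove_right_injective, by
    refine (X.isRelLowerSet_faces s.2.2).2 ?_ (Finset.univ_nonempty.image _)
    rw [← Finset.image_image]
    exact Finset.image_subset_image (Finset.subset_univ _)⟩

end OrderedSimplex

/-! ### Group actions -/

/-- The action of `Γ` on the vertices is an action on `X` by simplicial automorphisms. -/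
class SimplicialAction (Γ : Type*) [Group Γ] [MulAction Γ V] : Prop where
  image_mem : ∀ (g : Γ), ∀ σ ∈ X.faces, σ.image (fun v => g • v) ∈ X.faces

instance (Γ : Type*) [Group Γ] [MulAction Γ V] [X.SimplicialAction Γ] (k : ℕ) :
    MulAction Γ (X.OrderedSimplex k) where
  smul g s := ⟨fun i => g • s.1 i, fun _ _ h => s.2.1 (MulAction.injective g h), by
    have h := SimplicialAction.image_mem (X := X) g _ s.2.2
    rwa [Finset.image_image] at h⟩
  one_smul s := Subtype.ext (funext fun i => one_smul Γ (s.1 i))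
  mul_smul g h s := Subtype.ext (funext fun i => mul_smul g h (s.1 i))

/-- The action of the topological group `Γ` on `X` is (continuous and) proper: the action on the
discrete set of vertices is proper, i.e. all vertex stabilizers are open and compact. For a locally
finite complex this is the same as a proper action on the geometric realization. -/
def ActsProperly (_ : PureComplex V n) (Γ : Type*) [Group Γ] [TopologicalSpace Γ]
    [MulAction Γ V] : Prop :=
  letI : TopologicalSpace V := ⊥
  ProperSMul Γ V

/-- The action of `Γ` on `X` is cocompact: there are finitely many simplices whose translates
cover `X`. -/
def ActsCocompactly (Γ : Type*) [Group Γ] [MulAction Γ V] : Prop :=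
  ∃ F : Finset (Finset V), (∀ τ ∈ F, τ ∈ X.faces) ∧
    ∀ σ ∈ X.faces, ∃ τ ∈ F, ∃ g : Γ, σ = τ.image (fun v => g • v)

/-! ### Equivariant cohomology -/

section Cohomology

variable {Γ : Type*} [Group Γ] [MulAction Γ V] [X.SimplicialAction Γ]
  {𝕜 : Type*} [RCLike 𝕜] {E : Type*} [NormedAddCommGroup E] [NormedSpace 𝕜 E]
  (π : Γ →* (E ≃ₗᵢ[𝕜] E))

/-- The space `C^k(X, π)` of `k`-cochains twisted by `π`: the alternating and equivariant maps
`φ : Σ(k) → E`. -/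
def cochains (k : ℕ) : Submodule 𝕜 (X.OrderedSimplex k → E) where
  carrier := {φ |
    (∀ (γ : Equiv.Perm (Fin (k + 1))) (s : X.OrderedSimplex k),
      φ (s.perm γ) = Equiv.Perm.sign γ • φ s) ∧
    (∀ (g : Γ) (s : X.OrderedSimplex k), π g (φ s) = φ (g • s))}
  add_mem' := by
    rintro φ ψ ⟨h₁, h₂⟩ ⟨h₃, h₄⟩
    refine ⟨fun γ s => ?_, fun g s => ?_⟩
    · simp only [Pi.add_apply, h₁, h₃, smul_add]
    · simp only [Pi.add_apply, map_add, h₂, h₄]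
  zero_mem' := ⟨fun γ s => by simp, fun g s => by simp⟩
  smul_mem' := by
    rintro c φ ⟨h₁, h₂⟩
    refine ⟨fun γ s => ?_, fun g s => ?_⟩
    · simp only [Pi.smul_apply, h₁]
      exact smul_comm _ _ _
    · simp only [Pi.smul_apply, map_smul, h₂]

/-- The formula of the differential, on arbitrary maps `Σ(k) → E`:
`(dφ)(σ) = ∑_{i=0}^{k+1} (-1)^i φ(σ_i)`. -/
def differentialFun (k : ℕ) :
    (X.OrderedSimplex k → E) →ₗ[𝕜] (X.OrderedSimplex (k + 1) → E) where
  toFun φ s := ∑ i : Fin (k + 2), (-1 : ℤ) ^ (i : ℕ) • φ (s.face i)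
  map_add' φ ψ := by
    funext s
    simp only [Pi.add_apply, smul_add, Finset.sum_add_distrib]
  map_smul' c φ := by
    funext s
    simp only [Pi.smul_apply, RingHom.id_apply, Finset.smul_sum]
    exact Finset.sum_congr rfl fun i _ => smul_comm _ _ _

/-- A permutation `γ` maps the complement of `i` to the complement of `γ i`; the permutation that
it induces there has sign `(-1)^{i + γ(i)} sgn(γ)`. -/
theorem exists_induced_perm {m : ℕ} (γ : Equiv.Perm (Fin (m + 1))) (i : Fin (m + 1)) :
    ∃ δ : Equiv.Perm (Fin m), (∀ j, γ (i.succAbove j) = (γ i).succAbove (δ j)) ∧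
      (-1 : ℤˣ) ^ (i : ℕ) * Equiv.Perm.sign δ =
        Equiv.Perm.sign γ * (-1 : ℤˣ) ^ ((γ i : Fin (m + 1)) : ℕ) := by
  set ε : Equiv.Perm (Fin (m + 1)) := (γ i).cycleRange * γ * i.cycleRange⁻¹ with hε
  obtain ⟨⟨p, δ⟩, hp⟩ := Equiv.Perm.decomposeFin.symm.surjective ε
  have h0 : ε 0 = 0 := by
    have : i.cycleRange⁻¹ 0 = i := Fin.cycleRange_symm_zero i
    simp [hε, Equiv.Perm.mul_apply, this]
  have hp0 : p = 0 := by
    rw [← hp, Equiv.Perm.decomposeFin_symm_apply_zero] at h0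
    exact h0
  subst hp0
  refine ⟨δ, fun j => ?_, ?_⟩
  · have h1 : ε j.succ = (δ j).succ := by
      rw [← hp, Equiv.Perm.decomposeFin_symm_apply_succ]
      simp
    have h2 : i.cycleRange⁻¹ j.succ = i.succAbove j := Fin.cycleRange_symm_succ i j
    rw [hε, Equiv.Perm.mul_apply, Equiv.Perm.mul_apply, h2] at h1
    apply (γ i).cycleRange.injective
    rw [h1, Fin.cycleRange_succAbove]
  · have h3 : Equiv.Perm.sign ε = Equiv.Perm.sign δ := by
      rw [← hp, Equiv.Perm.decomposeFin.symm_sign]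
      simp
    rw [← h3, hε]
    simp only [Equiv.Perm.sign_mul, Equiv.Perm.sign_inv, Fin.sign_cycleRange]
    rw [mul_comm ((-1 : ℤˣ) ^ ((γ i : Fin (m + 1)) : ℕ)), mul_comm, mul_assoc,
      ← mul_pow]
    simp

theorem differentialFun_mem (k : ℕ) {φ : X.OrderedSimplex k → E} (hφ : φ ∈ X.cochains π k) :
    X.differentialFun (𝕜 := 𝕜) k φ ∈ X.cochains π (k + 1) := by
  obtain ⟨halt, heq⟩ := hφ
  refine ⟨fun γ s => ?_, fun g s => ?_⟩
  · change ∑ i : Fin (k + 2), (-1 : ℤ) ^ (i : ℕ) • φ ((s.perm γ).face i) =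
      Equiv.Perm.sign γ • ∑ i : Fin (k + 2), (-1 : ℤ) ^ (i : ℕ) • φ (s.face i)
    rw [← Equiv.sum_comp γ (fun i : Fin (k + 2) => (-1 : ℤ) ^ (i : ℕ) • φ (s.face i)),
      Finset.smul_sum]
    refine Finset.sum_congr rfl fun i _ => ?_
    obtain ⟨δ, hδ, hsign⟩ := exists_induced_perm γ i
    have hface : (s.perm γ).face i = (s.face (γ i)).perm δ :=
      Subtype.ext (funext fun j => congrArg s.1 (hδ j))
    rw [hface, halt]
    have hs := congrArg (fun u : ℤˣ => (u : ℤ)) hsign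
    simp only [Units.val_mul, Units.val_pow_eq_pow_val, Units.val_neg, Units.val_one] at hs
    simp only [Units.smul_def, smul_smul, hs]
  · change π g (∑ i : Fin (k + 2), (-1 : ℤ) ^ (i : ℕ) • φ (s.face i)) =
      ∑ i : Fin (k + 2), (-1 : ℤ) ^ (i : ℕ) • φ ((g • s).face i)
    rw [map_sum]
    refine Finset.sum_congr rfl fun i _ => ?_
    rw [map_zsmul, heq]
    rfl

/-- The vector space `C^k(X, π)`. -/
def Cochain (k : ℕ) : Type _ := X.cochains π k

instance (k : ℕ) : AddCommGroup (X.Cochain π k) := inferInstanceAs (AddCommGroup (X.cochains π k))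

instance (k : ℕ) : Module 𝕜 (X.Cochain π k) := inferInstanceAs (Module 𝕜 (X.cochains π k))

/-- The differential `d_k : C^k(X, π) → C^{k+1}(X, π)`. -/
def d (k : ℕ) : X.Cochain π k →ₗ[𝕜] X.Cochain π (k + 1) :=
  (X.differentialFun (𝕜 := 𝕜) k).restrict fun _ hφ => X.differentialFun_mem π k hφ

theorem d_comp_d (k : ℕ) : X.d π (k + 1) ∘ₗ X.d π k = 0 := by
  refine LinearMap.ext fun φ => Subtype.ext (funext fun s => ?_)
  change ∑ i : Fin (k + 3), (-1 : ℤ) ^ (i : ℕ) •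
    ∑ j : Fin (k + 2), (-1 : ℤ) ^ (j : ℕ) • φ.1 ((s.face i).face j) = 0
  simp only [Finset.smul_sum, Fin.sum_sum_eq_sum_triangle_add]
  refine Finset.sum_eq_zero fun i _ => Finset.sum_eq_zero fun j hj => ?_
  have hij : i ≤ j := Finset.mem_Ici.mp hj
  have hface : (s.face i.castSucc).face j = (s.face j.succ).face i := by
    refine Subtype.ext (funext fun l => congrArg s.1 ?_)
    have h := Fin.succAbove_succAbove_succAbove_predAbove j.succ i l
    have h1 : j.succ.succAbove i = i.castSucc := Fin.succAbove_of_castSucc_lt _ _ (by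
      simpa [Fin.lt_def, Nat.lt_succ_iff] using hij)
    have h2 : i.predAbove j.succ = j := by
      rw [Fin.predAbove_of_castSucc_lt _ _ (by simpa [Fin.lt_def, Nat.lt_succ_iff] using hij)]
      simp
    rw [h1, h2] at h
    exact h
  rw [hface]
  simp only [smul_smul, ← add_smul]
  convert zero_smul ℤ _ using 2
  simp only [Fin.val_castSucc, Fin.val_succ]
  ring

/-- The `k`-cocycles `Ker(d_k)`. -/
def cocycles (k : ℕ) : Submodule 𝕜 (X.Cochain π k) := LinearMap.ker (X.d π k)

/-- The `k`-coboundaries `Im(d_{k-1})`. -/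
def coboundaries : (k : ℕ) → Submodule 𝕜 (X.Cochain π k)
  | 0 => ⊥
  | k + 1 => LinearMap.range (X.d π k)

theorem coboundaries_le_cocycles (k : ℕ) : X.coboundaries π k ≤ X.cocycles π k := by
  cases k with
  | zero => exact bot_le
  | succ k => exact LinearMap.range_le_ker_iff.mpr (X.d_comp_d π k)

/-- The equivariant cohomology `H^k(X, π) = Ker(d_k) / Im(d_{k-1})`. -/
abbrev Cohomology (k : ℕ) : Type _ :=
  X.cocycles π k ⧸ (X.coboundaries π k).submoduleOf (X.cocycles π k)

end Cohomology

end PureComplex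

/-- A normed space is reflexive if the canonical embedding in its double dual is onto. -/
def IsReflexiveSpace (𝕜 : Type*) [RCLike 𝕜] (E : Type*) [NormedAddCommGroup E]
    [NormedSpace 𝕜 E] : Prop :=
  Function.Surjective (NormedSpace.inclusionInDoubleDual 𝕜 E)

/-- A locally compact group is unimodular if its modular character is trivial. -/
def IsUnimodular (Γ : Type*) [Group Γ] [TopologicalSpace Γ] [IsTopologicalGroup Γ]
    [LocallyCompactSpace Γ] : Prop :=
  ∀ g : Γ, MeasureTheory.Measure.modularCharacter g = 1

end GarlandBanach

end

namespace GarlandBanach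

set_option linter.unusedSectionVars false

open MeasureTheory Measure
open scoped ENNReal

/-! ### Invariant sums over orbits of a unimodular group -/

section DiscreteAction

variable {Γ : Type*} [Group Γ] [TopologicalSpace Γ] [MeasurableSpace Γ] [BorelSpace Γ]
  {S : Type*} [MulAction Γ S] [TopologicalSpace S] [DiscreteTopology S] [ContinuousSMul Γ S]

/-! The coboundary equation is solved by a Neumann series. For a `k`-cochain `φ` let `δφ` be the
average over links, `(δφ)(τ) = ∑ v, (m(vτ) / m(τ)) φ(vτ)`. Let `φ` be a cocycle and `s` a
`k`-simplex with faces `s_i`. The cocycle equation on `vs` reads `φ(s) = ∑ i, (-1)^i φ(v s_i)`.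
Averaging over `v` with the weights `m(vs) / m(s)`, whose sum is one because `k < n`, and
subtracting `dδφ(s)` leaves `∑ i, (-1)^i D_i(s)`, where `D_i(s)` is the value at the `i`-th vertex
of `s` of `A_τ (I - M_τ)` applied to `v ↦ φ(vτ)`, with `τ = s_i`
(`sub_differential_codifferential_eq`).

So `I - dδ` is, on cocycles, a signed sum of `k + 1` operators, each assembled from link operators
of norm less than `1 / (k + 1)`. To pass from links to `X`, cochains are measured by an energy: the
sum of `m(s) ‖φ(s)‖²` over ordered simplices, weighted by a cutoff function `χ` of the face `s_0`,
supported on finitely many simplices that meet every orbit. The `i`-th operator acts fibrewise over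
the `i`-th face, so its bound needs the weight `χ(s_i)` instead (`tsum_linkDefect_le`).
Unimodularity makes the weighted sum of an invariant function independent of the face used
(`IsUnimodular.exists_cutoff`, `exists_tuple_cutoff`).

By cocompactness one constant `C < 1 / (k + 1)` serves for all links that matter, and `energy_le`
shows that `I - dδ` multiplies the energy of a cocycle by at most `((k + 1) C)² < 1`. Energy
controls the value at each simplex, so `Φ = ∑ j, (I - dδ)^j φ` converges simplexwise by completeness
of `E`. The series telescopes to `dδΦ = φ`, and `δΦ` is the required primitive
(`exists_primitive_of_summable`). Throughout the formal proof `k = l + 1`. -/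

theorem measurable_comp_smul (f : S → ℝ≥0∞) (s : S) : Measurable fun g : Γ => f (g • s) :=
  (continuous_of_discreteTopology.comp (continuous_id.smul continuous_const)).measurable

theorem measurable_comp_inv_smul [ContinuousInv Γ] (f : S → ℝ≥0∞) (s : S) : Measurable fun g : Γ => f (g⁻¹ • s) :=
  (continuous_of_discreteTopology.comp (continuous_inv.smul continuous_const)).measurable

end DiscreteAction

/-- The sum of an invariant function against a cutoff function does not depend on the cutoff
function. -/
theorem tsum_cutoff_eq {Γ : Type*} [Group Γ] [MeasurableSpace Γ] (μ : Measure Γ)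
    {P : Type*} [MulAction Γ P] (a b : P → ℝ≥0∞)
    (F : P → ℝ≥0∞) (hF : ∀ (g : Γ) x, F (g • x) = F x)
    (ha : {x | a x * F x ≠ 0}.Finite) (hb : {x | b x * F x ≠ 0}.Finite)
    (hma : ∀ x, Measurable fun g : Γ => a (g • x))
    (hmb : ∀ x, Measurable fun g : Γ => b (g⁻¹ • x))
    (hia : ∀ x, F x ≠ 0 → ∫⁻ g : Γ, a (g • x) ∂μ = 1)
    (hib : ∀ x, F x ≠ 0 → ∫⁻ g : Γ, b (g⁻¹ • x) ∂μ = 1) :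
    ∑' x, a x * F x = ∑' x, b x * F x := by
  have hA : ∀ c : P → ℝ≥0∞, ∀ x ∉ ha.toFinset, a x * F x * c x = 0 := fun c x hx => by
    have : a x * F x = 0 := not_not.mp fun h => hx (by simpa using h)
    rw [this, zero_mul]
  have hB : ∀ c : P → ℝ≥0∞, ∀ x ∉ hb.toFinset, b x * F x * c x = 0 := fun c x hx => by
    have : b x * F x = 0 := not_not.mp fun h => hx (by simpa using h)
    rw [this, zero_mul]
  calc ∑' x, a x * F x = ∑' x, a x * F x * ∫⁻ g : Γ, b (g⁻¹ • x) ∂μ := by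
        refine tsum_congr fun x => ?_
        by_cases hx : F x = 0
        · simp [hx]
        · rw [hib x hx, mul_one]
    _ = ∑ x ∈ ha.toFinset, ∫⁻ g : Γ, a x * F x * b (g⁻¹ • x) ∂μ := by
        rw [tsum_eq_sum (hA _)]
        exact Finset.sum_congr rfl fun x _ => (lintegral_const_mul _ (hmb x)).symm
    _ = ∫⁻ g : Γ, ∑' x, a x * F x * b (g⁻¹ • x) ∂μ := by
        rw [← lintegral_finsetSum _ fun x _ => (hmb x).const_mul _]
        exact lintegral_congr fun g => (tsum_eq_sum (hA fun x => b (g⁻¹ • x))).symm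
    -- For fixed `g`, substitute `g • x` for `x`: invariance of `F` moves the translation from `b`
    -- to `a`. The two averages therefore run over `g⁻¹` and over `g` respectively.
    _ = ∫⁻ g : Γ, ∑' x, b x * F x * a (g • x) ∂μ := by
        refine lintegral_congr fun g => ?_
        rw [← (MulAction.toPerm g : Equiv.Perm P).tsum_eq]
        refine tsum_congr fun x => ?_
        simp only [MulAction.toPerm_apply, hF, inv_smul_smul]
        ring
    _ = ∑ x ∈ hb.toFinset, ∫⁻ g : Γ, b x * F x * a (g • x) ∂μ := by
        rw [← lintegral_finsetSum _ fun x _ => (hma x).const_mul _]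
        exact lintegral_congr fun g => tsum_eq_sum (hB fun x => a (g • x))
    _ = ∑' x, b x * F x * ∫⁻ g : Γ, a (g • x) ∂μ := by
        rw [tsum_eq_sum (hB _)]
        exact Finset.sum_congr rfl fun x _ => lintegral_const_mul _ (hma x)
    _ = ∑' x, b x * F x := by
        refine tsum_congr fun x => ?_
        by_cases hx : F x = 0
        · simp [hx]
        · rw [hia x hx, mul_one]

/-! ### Haar measure of transporters for a unimodular group -/

section Unimodular

variable {Γ : Type*} [Group Γ] [TopologicalSpace Γ] [IsTopologicalGroup Γ] [LocallyCompactSpace Γ]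
  [MeasurableSpace Γ] [BorelSpace Γ]

/-- The modular character is the factor between a Haar measure and its right translate. Restricting
to sets with compact closure lets uniqueness of Haar measure apply without any regularity of `μ`. -/
theorem IsUnimodular.measure_mul_right (hΓ : IsUnimodular Γ) (μ : Measure Γ) [IsHaarMeasure μ]
    {A : Set Γ} (hA : IsCompact (closure A)) (h : Γ) :
    μ ((fun g => g * h) ⁻¹' A) = μ A := by
  have h1 : haarScalarFactor (map (· * h) μ) μ = 1 := by
    rw [← modularCharacterFun_eq_haarScalarFactor]
    exact hΓ h
  have h2 := measure_isMulInvariant_eq_smul_of_isCompact_closure (map (· * h) μ) μ hA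
  rw [h1, one_smul] at h2
  rw [← h2]
  exact ((MeasurableEquiv.mulRight h).map_apply A).symm

variable {S : Type*} [MulAction Γ S]

/-- If `r = h • s`, then `g⁻¹ • s = r` holds exactly when `h * g * h` carries `s` to `r`. The left
factor preserves `μ` by left invariance, the right one by unimodularity. -/
theorem IsUnimodular.measure_transporter_comm [T2Space Γ] (hΓ : IsUnimodular Γ) (μ : Measure Γ)
    [IsHaarMeasure μ] (hc : ∀ s r : S, IsCompact {g : Γ | g • s = r}) (s r : S) :
    μ {g : Γ | g⁻¹ • s = r} = μ {g : Γ | g • s = r} := by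
  by_cases hne : ∃ h : Γ, h • s = r
  · obtain ⟨h, rfl⟩ := hne
    have h1 : {g : Γ | g⁻¹ • s = h • s} =
        (fun g => h * g) ⁻¹' ((fun g => g * h) ⁻¹' {g : Γ | g • s = h • s}) := by
      ext g
      simp only [Set.mem_ofPred_eq, Set.mem_preimage]
      rw [inv_smul_eq_iff, mul_assoc, mul_smul, smul_left_cancel_iff, mul_smul, eq_comm]
    rw [h1, measure_preimage_mul, hΓ.measure_mul_right μ]
    exact (hc _ _).closure
  · have h1 : {g : Γ | g⁻¹ • s = r} = ∅ := by
      ext g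
      simp only [Set.mem_ofPred_eq, Set.mem_empty_iff_false, iff_false]
      exact fun h => hne ⟨_, h⟩
    have h2 : {g : Γ | g • s = r} = ∅ := by
      ext g
      simp only [Set.mem_ofPred_eq, Set.mem_empty_iff_false, iff_false]
      exact fun h => hne ⟨_, h⟩
    rw [h1, h2]

variable [TopologicalSpace S] [DiscreteTopology S] [ContinuousSMul Γ S]

/-- A finitely supported `χ` is a finite combination of indicators of points, and for these the two
integrals are measures of transporters. Thus one normalisation of a cutoff function serves for
averages over `g` and over `g⁻¹`. -/
theorem IsUnimodular.lintegral_comp_inv_smul [T2Space Γ] (hΓ : IsUnimodular Γ) (μ : Measure Γ)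
    [IsHaarMeasure μ] (hc : ∀ s r : S, IsCompact {g : Γ | g • s = r}) (R : Finset S)
    (χ : S → ℝ≥0∞) (hχ : ∀ t ∉ R, χ t = 0) (s : S) :
    ∫⁻ g, χ (g⁻¹ • s) ∂μ = ∫⁻ g, χ (g • s) ∂μ := by
  classical
  have hdec : ∀ t, χ t = ∑ r ∈ R, χ r * ({r} : Set S).indicator 1 t := by
    intro t
    by_cases ht : t ∈ R
    · rw [Finset.sum_eq_single t]
      · simp
      · intro b _ hb
        simp [hb.symm]
      · exact fun h => (h ht).elim
    · rw [hχ t ht, Finset.sum_eq_zero]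
      intro r hr
      have : t ≠ r := fun h => ht (h ▸ hr)
      simp [this]
  have hm1 : ∀ r : S, ∫⁻ g : Γ, ({r} : Set S).indicator 1 (g • s) ∂μ = μ {g : Γ | g • s = r} := by
    intro r
    have : MeasurableSet {g : Γ | g • s = r} := (hc s r).measurableSet
    rw [← lintegral_indicator_one this]
    rfl
  have hm2 : ∀ r : S, ∫⁻ g : Γ, ({r} : Set S).indicator 1 (g⁻¹ • s) ∂μ =
      μ {g : Γ | g⁻¹ • s = r} := by
    intro r
    have : MeasurableSet {g : Γ | g⁻¹ • s = r} := (hc s r).measurableSet.inv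
    rw [← lintegral_indicator_one this]
    rfl
  rw [lintegral_congr fun g : Γ => hdec (g⁻¹ • s), lintegral_congr fun g : Γ => hdec (g • s),
    lintegral_finsetSum, lintegral_finsetSum]
  · refine Finset.sum_congr rfl fun r _ => ?_
    rw [lintegral_const_mul, lintegral_const_mul, hm1, hm2, hΓ.measure_transporter_comm μ hc]
    · exact measurable_comp_smul _ _
    · exact measurable_comp_inv_smul _ _
  · exact fun r _ => (measurable_comp_smul _ _).const_mul _
  · exact fun r _ => (measurable_comp_inv_smul _ _).const_mul _

end Unimodular

variable {Γ : Type*} [Group Γ] [TopologicalSpace Γ] [IsTopologicalGroup Γ] [LocallyCompactSpace Γ]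

/-- For a proper action of a unimodular group on a discrete set `S` and a finite set `R`, there is a
weight supported on `R` such that the weighted sums of an invariant function along two
equivariant maps to `Γ R` coincide. -/
theorem IsUnimodular.exists_cutoff [T2Space Γ] (hΓ : IsUnimodular Γ) {S : Type*} [MulAction Γ S]
    [TopologicalSpace S] [DiscreteTopology S] [ContinuousSMul Γ S]
    (hc : ∀ s r : S, IsCompact {g : Γ | g • s = r}) (R : Finset S) :
    ∃ χ : S → ℝ≥0∞, (∀ t ∉ R, χ t = 0) ∧ (∀ t, χ t ≠ ∞) ∧ (∀ t ∈ R, χ t ≠ 0) ∧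
      ∀ {P : Type _} [MulAction Γ P] (p q : P → S) (F : P → ℝ≥0∞),
        (∀ (g : Γ) x, p (g • x) = g • p x) → (∀ (g : Γ) x, q (g • x) = g • q x) →
        (∀ (g : Γ) x, F (g • x) = F x) →
        (∀ x, F x ≠ 0 → ∃ g : Γ, g • p x ∈ R) → (∀ x, F x ≠ 0 → ∃ g : Γ, g • q x ∈ R) →
        (∀ t, {x | p x = t ∧ F x ≠ 0}.Finite) → (∀ t, {x | q x = t ∧ F x ≠ 0}.Finite) →
        ∑' x, χ (p x) * F x = ∑' x, χ (q x) * F x := by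
  classical
  borelize Γ
  set μ : Measure Γ := haar
  -- `N` is invariant by left invariance of `μ`, finite because transporters are compact, and
  -- positive on `Γ R` because the set it measures is open. Dividing the indicator of `R` by `N`
  -- gives a function whose averages over orbits in `Γ R` are one.
  set N : S → ℝ≥0∞ := fun s => ∫⁻ g : Γ, (R : Set S).indicator 1 (g⁻¹ • s) ∂μ with hN
  have hNμ : ∀ s, N s = μ {g : Γ | g⁻¹ • s ∈ R} := by
    intro s
    have hmeas : MeasurableSet {g : Γ | g⁻¹ • s ∈ R} :=
      ((isOpen_discrete (R : Set S)).preimage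
        ((continuous_inv (G := Γ)).smul continuous_const)).measurableSet
    rw [← lintegral_indicator_one hmeas]
    rfl
  have hNtop : ∀ s, N s ≠ ∞ := by
    intro s
    have hU : {g : Γ | g⁻¹ • s ∈ R} = ⋃ r ∈ R, {g : Γ | g • r = s} := by
      ext g
      simp only [Set.mem_ofPred_eq, Set.mem_iUnion, exists_prop]
      constructor
      · exact fun h => ⟨_, h, smul_inv_smul _ _⟩
      · rintro ⟨r, hr, rfl⟩
        rwa [inv_smul_smul]
    rw [hNμ, hU]
    exact (R.isCompact_biUnion fun r _ => hc r s).measure_lt_top.ne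
  have hNpos : ∀ s, (∃ g : Γ, g • s ∈ R) → N s ≠ 0 := by
    rintro s ⟨g, hg⟩
    rw [hNμ]
    refine (IsOpen.measure_pos μ ?_ ⟨g⁻¹, by simpa using hg⟩).ne'
    exact (isOpen_discrete (R : Set S)).preimage
      ((continuous_inv (G := Γ)).smul continuous_const)
  have hNinv : ∀ (h : Γ) s, N (h⁻¹ • s) = N s := by
    intro h s
    simp only [hN]
    rw [← lintegral_mul_left_eq_self (μ := μ) (fun g : Γ => (R : Set S).indicator 1 (g⁻¹ • s)) h]
    simp only [mul_inv_rev, mul_smul]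
  set χ : S → ℝ≥0∞ := fun s => (R : Set S).indicator 1 s * (N s)⁻¹ with hχ
  have hχR : ∀ t ∉ R, χ t = 0 := fun t ht => by simp [hχ, ht]
  have hχint : ∀ s, (∃ g : Γ, g • s ∈ R) → ∫⁻ g : Γ, χ (g⁻¹ • s) ∂μ = 1 := by
    intro s hs
    simp only [hχ, hNinv]
    rw [lintegral_mul_const _ (measurable_comp_inv_smul _ _)]
    exact ENNReal.mul_inv_cancel (hNpos s hs) (hNtop s)
  refine ⟨χ, hχR, fun t => ?_, fun t ht => ?_, ?_⟩
  · by_cases ht : t ∈ R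
    · have h1 : N t ≠ 0 := hNpos t ⟨1, by simpa using ht⟩
      simp [hχ, ht, h1]
    · simp [hχR t ht]
  · simp [hχ, ht, hNtop]
  · intro P _ p q F hp hq hF hpR hqR hpf hqf
    have hfin : ∀ r : P → S, (∀ t, {x | r x = t ∧ F x ≠ 0}.Finite) →
        {x | χ (r x) * F x ≠ 0}.Finite := by
      intro r hr
      refine (R.finite_toSet.biUnion fun t _ => hr t).subset fun x hx => ?_
      have hx1 : χ (r x) ≠ 0 := left_ne_zero_of_mul hx
      have hx2 : r x ∈ R := by
        by_contra h
        exact hx1 (hχR _ h)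
      exact Set.mem_biUnion hx2 ⟨rfl, right_ne_zero_of_mul hx⟩
    refine tsum_cutoff_eq μ _ _ F hF (hfin p hpf) (hfin q hqf) ?_ ?_ ?_ ?_
    · intro x
      simp only [hp]
      exact measurable_comp_smul _ _
    · intro x
      simp only [hq]
      exact measurable_comp_inv_smul _ _
    · intro x hx
      simp only [hp]
      rw [← hΓ.lintegral_comp_inv_smul μ hc R χ hχR]
      exact hχint _ (hpR x hx)
    · intro x hx
      simp only [hq]
      exact hχint _ (hqR x hx)

namespace PureComplex

variable {V : Type*} [DecidableEq V] {n : ℕ} (X : PureComplex V n)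

/-! ### Weights of tuples of vertices -/

theorem finite_cofaces {τ : Finset V} (hτ : τ.Nonempty) :
    {σ : Finset V | σ ∈ X.faces ∧ σ.card = n + 1 ∧ τ ⊆ σ}.Finite := by
  obtain ⟨v, hv⟩ := hτ
  exact (X.locallyFinite v).subset fun σ hσ => ⟨hσ.1, hσ.2.1, hσ.2.2 hv⟩

theorem weight_pos {τ : Finset V} (hτ : τ ∈ X.faces) : 0 < X.weight τ := by
  obtain ⟨ρ, hρ, hsub, hcard⟩ := X.pure τ hτ
  refine mul_pos (Nat.cast_pos.mpr (Nat.factorial_pos _)) (Nat.cast_pos.mpr ?_)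
  rw [Set.ncard_pos (X.finite_cofaces (X.isRelLowerSet_faces hτ).1)]
  exact ⟨ρ, hρ, hcard, hsub⟩

/-- A tuple of distinct vertices spanning a face. -/
def IsSimplex {j : ℕ} (t : Fin j → V) : Prop :=
  Function.Injective t ∧ Finset.univ.image t ∈ X.faces

open Classical in
/-- The weight of the face spanned by a tuple of vertices, and zero if the tuple is not an ordered
simplex. -/
noncomputable def tupleWeight {j : ℕ} (t : Fin j → V) : ℝ :=
  if X.IsSimplex t then X.weight (Finset.univ.image t) else 0

variable {X}

theorem IsSimplex.card_image {j : ℕ} {t : Fin j → V} (ht : X.IsSimplex t) :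
    (Finset.univ.image t).card = j := by
  rw [Finset.card_image_of_injective _ ht.1, Finset.card_fin]

theorem isSimplex_iff {j : ℕ} {t : Fin j → V} :
    X.IsSimplex t ↔ (Finset.univ.image t).card = j ∧ Finset.univ.image t ∈ X.faces := by
  refine ⟨fun h => ⟨h.card_image, h.2⟩, fun h => ⟨?_, h.2⟩⟩
  have := Finset.card_image_iff.mp (h.1.trans (Finset.card_fin j).symm)
  rwa [Finset.coe_univ, Set.injOn_univ] at this

theorem isSimplex_congr {j : ℕ} {s t : Fin j → V}
    (h : Finset.univ.image s = Finset.univ.image t) : X.IsSimplex s ↔ X.IsSimplex t := by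
  rw [isSimplex_iff, isSimplex_iff, h]

theorem tupleWeight_of_isSimplex {j : ℕ} {t : Fin j → V} (ht : X.IsSimplex t) :
    X.tupleWeight t = X.weight (Finset.univ.image t) := if_pos ht

theorem tupleWeight_of_not_isSimplex {j : ℕ} {t : Fin j → V} (ht : ¬ X.IsSimplex t) :
    X.tupleWeight t = 0 := if_neg ht

theorem tupleWeight_congr {j : ℕ} {s t : Fin j → V}
    (h : Finset.univ.image s = Finset.univ.image t) : X.tupleWeight s = X.tupleWeight t := by
  by_cases hs : X.IsSimplex s
  · rw [tupleWeight_of_isSimplex hs, tupleWeight_of_isSimplex ((isSimplex_congr h).mp hs), h]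
  · rw [tupleWeight_of_not_isSimplex hs,
      tupleWeight_of_not_isSimplex fun ht => hs ((isSimplex_congr h).mpr ht)]

theorem tupleWeight_pos {j : ℕ} {t : Fin j → V} (ht : X.IsSimplex t) : 0 < X.tupleWeight t := by
  rw [tupleWeight_of_isSimplex ht]
  exact X.weight_pos ht.2

theorem tupleWeight_nonneg {j : ℕ} (t : Fin j → V) : 0 ≤ X.tupleWeight t := by
  by_cases ht : X.IsSimplex t
  · exact (tupleWeight_pos ht).le
  · rw [tupleWeight_of_not_isSimplex ht]

theorem image_cons {j : ℕ} (v : V) (t : Fin j → V) :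
    Finset.univ.image (Fin.cons v t : Fin (j + 1) → V) = insert v (Finset.univ.image t) := by
  ext x
  simp [Fin.exists_fin_succ, eq_comm]

theorem image_insertNth {j : ℕ} (i : Fin (j + 1)) (v : V) (t : Fin j → V) :
    Finset.univ.image (i.insertNth v t : Fin (j + 1) → V) = insert v (Finset.univ.image t) := by
  ext x
  simp only [Finset.mem_image, Finset.mem_univ, true_and, Finset.mem_insert]
  rw [Fin.exists_iff_succAbove i]
  simp [eq_comm]

theorem tupleWeight_insertNth {j : ℕ} (i : Fin (j + 1)) (v : V) (t : Fin j → V) :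
    X.tupleWeight (i.insertNth v t : Fin (j + 1) → V) =
      X.tupleWeight (Fin.cons v t : Fin (j + 1) → V) :=
  tupleWeight_congr (by rw [image_cons, image_insertNth])

theorem tupleWeight_cons_insertNth {j : ℕ} (i : Fin (j + 1)) (u v : V) (t : Fin j → V) :
    X.tupleWeight (Fin.cons u (i.insertNth v t : Fin (j + 1) → V) : Fin (j + 2) → V) =
      X.tupleWeight (Fin.cons u (Fin.cons v t : Fin (j + 1) → V) : Fin (j + 2) → V) :=
  tupleWeight_congr (by rw [image_cons, image_cons, image_cons, image_insertNth])

theorem IsSimplex.removeNth {j : ℕ} {s : Fin (j + 2) → V} (hs : X.IsSimplex s) (i : Fin (j + 2)) :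
    X.IsSimplex (i.removeNth s) :=
  (OrderedSimplex.face (X := X) ⟨s, hs⟩ i).2

theorem IsSimplex.of_cons {j : ℕ} {v : V} {t : Fin (j + 1) → V}
    (h : X.IsSimplex (Fin.cons v t : Fin (j + 2) → V)) : X.IsSimplex t := by
  have := h.removeNth 0
  rwa [Fin.removeNth_zero, Fin.tail_cons] at this

theorem isSimplex_cons_iff {j : ℕ} {v : V} {t : Fin (j + 1) → V} (ht : X.IsSimplex t) :
    X.IsSimplex (Fin.cons v t : Fin (j + 2) → V) ↔
      v ∉ Finset.univ.image t ∧ insert v (Finset.univ.image t) ∈ X.faces := by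
  rw [isSimplex_iff, image_cons]
  refine and_congr_left fun _ => ?_
  by_cases hv : v ∈ Finset.univ.image t
  · rw [Finset.insert_eq_of_mem hv, ht.card_image]
    simp [hv]
  · rw [Finset.card_insert_of_notMem hv, ht.card_image]
    simp only [hv, not_false_eq_true]

theorem finite_setOf_isSimplex_cons {j : ℕ} (t : Fin (j + 1) → V) :
    {v | X.IsSimplex (Fin.cons v t : Fin (j + 2) → V)}.Finite := by
  refine ((X.finite_cofaces (τ := {t 0}) (Finset.singleton_nonempty _)).biUnion
    fun ρ _ => ρ.finite_toSet).subset fun v hv => ?_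
  obtain ⟨ρ, hρ, hsub, hcard⟩ := X.pure _ hv.2
  rw [image_cons] at hsub
  refine Set.mem_biUnion (x := ρ) ⟨hρ, hcard, ?_⟩ (hsub (Finset.mem_insert_self _ _))
  rw [Finset.singleton_subset_iff]
  exact hsub (Finset.mem_insert_of_mem (Finset.mem_image_of_mem _ (Finset.mem_univ _)))

theorem support_tupleWeight_cons_subset {j : ℕ} (t : Fin (j + 1) → V) :
    (Function.support fun v => X.tupleWeight (Fin.cons v t : Fin (j + 2) → V)) ⊆
      {v | X.IsSimplex (Fin.cons v t : Fin (j + 2) → V)} := by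
  intro v hv
  by_contra h
  exact hv (tupleWeight_of_not_isSimplex h)

/-- If the enlarged set is not a face, no `n`-simplex contains it, so both sides vanish. Hence the
count below needs no case distinction. -/
theorem tupleWeight_cons_eq {j : ℕ} {t : Fin (j + 1) → V} (ht : X.IsSimplex t) {v : V}
    (hv : v ∉ Finset.univ.image t) :
    X.tupleWeight (Fin.cons v t : Fin (j + 2) → V) = X.weight (insert v (Finset.univ.image t)) := by
  by_cases h : X.IsSimplex (Fin.cons v t : Fin (j + 2) → V)
  · rw [tupleWeight_of_isSimplex h, image_cons]
  · rw [tupleWeight_of_not_isSimplex h, weight]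
    have : {σ : Finset V | σ ∈ X.faces ∧ σ.card = n + 1 ∧
        insert v (Finset.univ.image t) ⊆ σ} = ∅ := by
      rw [Set.eq_empty_iff_forall_notMem]
      rintro σ ⟨hσ, -, hsub⟩
      exact h ((isSimplex_cons_iff ht).mpr
        ⟨hv, (X.isRelLowerSet_faces hσ).2 hsub (Finset.insert_nonempty _ _)⟩)
    rw [this, Set.ncard_empty, Nat.cast_zero, mul_zero]

/-- The weight of a simplex of positive codimension is the sum of the weights of its cofaces of
codimension one. -/
theorem finsum_tupleWeight_cons {j : ℕ} (hj : j + 1 ≤ n) (t : Fin (j + 1) → V) :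
    ∑ᶠ v, X.tupleWeight (Fin.cons v t : Fin (j + 2) → V) = X.tupleWeight t := by
  by_cases ht : X.IsSimplex t
  swap
  · rw [tupleWeight_of_not_isSimplex ht, finsum_eq_zero_of_forall_eq_zero]
    exact fun v => tupleWeight_of_not_isSimplex fun h => ht h.of_cons
  set τ := Finset.univ.image t with hτ
  have hcard : τ.card = j + 1 := ht.card_image
  have hne : τ.Nonempty := Finset.univ_nonempty.image _
  set C : Finset (Finset V) := (X.finite_cofaces hne).toFinset with hC
  have hmemC : ∀ ρ, ρ ∈ C ↔ ρ ∈ X.faces ∧ ρ.card = n + 1 ∧ τ ⊆ ρ :=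
    fun ρ => Set.Finite.mem_toFinset _
  set U : Finset V := C.biUnion id \ τ with hU
  have hw : ∀ v ∉ τ, X.weight (insert v τ) =
      ((n - (j + 1)).factorial : ℝ) * ((C.filter fun ρ => v ∈ ρ).card : ℝ) := by
    intro v hv
    rw [weight, Finset.card_insert_of_notMem hv, hcard, Nat.add_sub_add_right,
      ← Set.ncard_coe_finset]
    congr 3
    ext ρ
    simp only [Set.mem_ofPred_eq, Finset.coe_filter, hmemC, Finset.insert_subset_iff]
    tauto
  rw [finsum_eq_sum_of_support_subset (s := U)]
  · have h1 : ∀ v ∈ U, X.tupleWeight (Fin.cons v t : Fin (j + 2) → V) =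
        ((n - (j + 1)).factorial : ℝ) * ((C.filter fun ρ => v ∈ ρ).card : ℝ) := by
      intro v hv
      have hvτ : v ∉ τ := (Finset.mem_sdiff.mp hv).2
      rw [tupleWeight_cons_eq ht hvτ, hw v hvτ]
    -- Count pairs `(v, ρ)` with `v ∈ ρ \ τ` the other way: each `n`-simplex `ρ ⊇ τ` has `(n + 1) -
    -- (j + 1)` vertices outside `τ`. The factorials in the weights absorb exactly this factor.
    have h2 : ∑ v ∈ U, (C.filter fun ρ => v ∈ ρ).card = C.card * (n - j) := by
      have := Finset.sum_card_bipartiteAbove_eq_sum_card_bipartiteBelow (s := U) (t := C)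
        (fun v ρ => v ∈ ρ)
      simp only [Finset.bipartiteAbove, Finset.bipartiteBelow] at this
      rw [this, Finset.sum_const_nat]
      intro ρ hρ
      have h3 : (U.filter fun v => v ∈ ρ) = ρ \ τ := by
        ext v
        simp only [hU, Finset.mem_filter, Finset.mem_sdiff, Finset.mem_biUnion, id]
        exact ⟨fun h => ⟨h.2, h.1.2⟩, fun h => ⟨⟨⟨ρ, hρ, h.1⟩, h.2⟩, h.1⟩⟩
      obtain ⟨-, h4, h5⟩ := (hmemC ρ).mp hρ
      rw [h3, Finset.card_sdiff_of_subset h5, h4, hcard, Nat.add_sub_add_right]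
    rw [Finset.sum_congr rfl h1, ← Finset.mul_sum, ← Nat.cast_sum, h2,
      tupleWeight_of_isSimplex ht, weight, ← hτ, hcard, Nat.add_sub_add_right]
    have h6 : {σ : Finset V | σ ∈ X.faces ∧ σ.card = n + 1 ∧ τ ⊆ σ}.ncard = C.card := by
      rw [← Set.ncard_coe_finset, hC, Set.Finite.coe_toFinset]
    have h7 : (n - j).factorial = (n - j) * (n - (j + 1)).factorial := by
      have : n - j = (n - (j + 1)) + 1 := by omega
      rw [this, Nat.factorial_succ]
    rw [h6, h7]
    push_cast
    ring
  · intro v hv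
    have hs := support_tupleWeight_cons_subset t hv
    obtain ⟨h1, h2⟩ := (isSimplex_cons_iff ht).mp hs
    obtain ⟨ρ, hρ, hsub, hρc⟩ := X.pure _ h2
    refine Finset.mem_sdiff.mpr ⟨Finset.mem_biUnion.mpr ⟨ρ, (hmemC ρ).mpr ⟨hρ, hρc, ?_⟩, ?_⟩, h1⟩
    · exact (Finset.subset_insert _ _).trans hsub
    · exact hsub (Finset.mem_insert_self _ _)

/-! ### Invariance of simplices and weights under the group -/

section Action

variable {Γ : Type*} [Group Γ] [MulAction Γ V] [X.SimplicialAction Γ]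

variable (X) in
theorem image_smul_mem_faces_iff (g : Γ) (σ : Finset V) :
    σ.image (fun v => g • v) ∈ X.faces ↔ σ ∈ X.faces := by
  refine ⟨fun h => ?_, SimplicialAction.image_mem g σ⟩
  have := SimplicialAction.image_mem (X := X) g⁻¹ _ h
  rw [Finset.image_image] at this
  simpa [Function.comp_def] using this

variable (X) in
theorem weight_image_smul (g : Γ) (τ : Finset V) :
    X.weight (τ.image fun v => g • v) = X.weight τ := by
  have hinj : Function.Injective fun v : V => g • v := MulAction.injective g
  rw [weight, weight, Finset.card_image_of_injective _ hinj]
  congr 2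
  symm
  refine Set.ncard_congr (fun σ _ => σ.image fun v => g • v) ?_ ?_ ?_
  · rintro σ ⟨h1, h2, h3⟩
    exact ⟨SimplicialAction.image_mem g σ h1, by rwa [Finset.card_image_of_injective _ hinj],
      Finset.image_subset_image h3⟩
  · intro σ ρ _ _ h
    exact Finset.image_injective hinj h
  · rintro σ ⟨h1, h2, h3⟩
    have hσ : (σ.image fun v => g⁻¹ • v).image (fun v => g • v) = σ := by
      rw [Finset.image_image]
      simp [Function.comp_def]
    refine ⟨σ.image fun v => g⁻¹ • v, ⟨SimplicialAction.image_mem g⁻¹ σ h1, ?_, ?_⟩, hσ⟩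
    · rw [Finset.card_image_of_injective _ (MulAction.injective _), h2]
    · rwa [← Finset.image_subset_image_iff hinj, hσ]

theorem image_smul_tuple {j : ℕ} (g : Γ) (t : Fin j → V) :
    Finset.univ.image (g • t) = (Finset.univ.image t).image fun v => g • v := by
  rw [Finset.image_image]
  rfl

theorem isSimplex_smul_iff {j : ℕ} (g : Γ) (t : Fin j → V) :
    X.IsSimplex (g • t) ↔ X.IsSimplex t := by
  rw [isSimplex_iff, isSimplex_iff, image_smul_tuple, image_smul_mem_faces_iff,
    Finset.card_image_of_injective _ (MulAction.injective g)]

theorem tupleWeight_smul {j : ℕ} (g : Γ) (t : Fin j → V) :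
    X.tupleWeight (g • t) = X.tupleWeight t := by
  by_cases ht : X.IsSimplex t
  · rw [tupleWeight_of_isSimplex ht, tupleWeight_of_isSimplex ((isSimplex_smul_iff g t).mpr ht),
      image_smul_tuple, weight_image_smul]
  · rw [tupleWeight_of_not_isSimplex ht,
      tupleWeight_of_not_isSimplex fun h => ht ((isSimplex_smul_iff g t).mp h)]

theorem smul_cons {j : ℕ} (g : Γ) (v : V) (t : Fin j → V) :
    g • (Fin.cons v t : Fin (j + 1) → V) = (Fin.cons (g • v) (g • t) : Fin (j + 1) → V) := by
  ext i
  refine Fin.cases ?_ (fun i => ?_) i <;> simp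

theorem smul_removeNth {j : ℕ} (g : Γ) (i : Fin (j + 1)) (s : Fin (j + 1) → V) :
    i.removeNth (g • s) = g • (i.removeNth s : Fin j → V) := rfl

end Action

end PureComplex

/-! ### Operator norms on finite weighted graphs -/

section Bound

variable {W : Type*} [Fintype W] {𝕜 : Type*} [RCLike 𝕜] {E : Type*} [NormedAddCommGroup E]
  [NormedSpace 𝕜 E]

theorem l2Norm_nonneg (m : W → ℝ) (φ : W → E) : 0 ≤ l2Norm m φ := Real.sqrt_nonneg _

theorem l2Norm_sq {m : W → ℝ} (hm : ∀ v, 0 < m v) (φ : W → E) :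
    l2Norm m φ ^ 2 = ∑ v, m v * ‖φ v‖ ^ 2 :=
  Real.sq_sqrt (Finset.sum_nonneg fun v _ => mul_nonneg (hm v).le (sq_nonneg _))

theorem sqrt_mul_norm_le_l2Norm {m : W → ℝ} (hm : ∀ v, 0 < m v) (φ : W → E) (v : W) :
    √(m v) * ‖φ v‖ ≤ l2Norm m φ := by
  refine Real.le_sqrt_of_sq_le ?_
  rw [mul_pow, Real.sq_sqrt (hm v).le]
  exact Finset.single_le_sum (f := fun v => m v * ‖φ v‖ ^ 2)
    (fun v _ => mul_nonneg (hm v).le (sq_nonneg _)) (Finset.mem_univ v)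

theorem l2Norm_le_sum {m : W → ℝ} (hm : ∀ v, 0 < m v) (φ : W → E) :
    l2Norm m φ ≤ ∑ v, √(m v) * ‖φ v‖ := by
  have h0 : ∀ v, 0 ≤ √(m v) * ‖φ v‖ := fun v => mul_nonneg (Real.sqrt_nonneg _) (norm_nonneg _)
  refine Real.sqrt_le_iff.mpr ⟨Finset.sum_nonneg fun v _ => h0 v, ?_⟩
  refine le_trans (le_of_eq ?_) (Finset.sum_sq_le_sq_sum_of_nonneg fun v _ => h0 v)
  exact Finset.sum_congr rfl fun v _ => by rw [mul_pow, Real.sq_sqrt (hm v).le]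

variable [DecidableEq W]

/-- A crude bound by matrix coefficients. It shows that the set whose infimum defines `l2OpNorm` is
nonempty, so that a bound on the infimum carries information. -/
theorem exists_l2Norm_tensorId_le {m : W → ℝ} (hm : ∀ v, 0 < m v) (T : (W → 𝕜) →ₗ[𝕜] (W → 𝕜)) :
    ∃ K : ℝ, 0 ≤ K ∧ ∀ φ : W → E, l2Norm m (tensorId T E φ) ≤ K * l2Norm m φ := by
  refine ⟨∑ v, √(m v) * ∑ u, ‖T (Pi.single u 1) v‖ * (√(m u))⁻¹, ?_, fun φ => ?_⟩
  · exact Finset.sum_nonneg fun v _ => mul_nonneg (Real.sqrt_nonneg _) <|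
      Finset.sum_nonneg fun u _ => mul_nonneg (norm_nonneg _) (inv_nonneg.mpr (Real.sqrt_nonneg _))
  · refine (l2Norm_le_sum hm _).trans ?_
    rw [Finset.sum_mul]
    refine Finset.sum_le_sum fun v _ => ?_
    rw [mul_assoc, Finset.sum_mul]
    refine mul_le_mul_of_nonneg_left ?_ (Real.sqrt_nonneg _)
    refine (norm_sum_le _ _).trans (Finset.sum_le_sum fun u _ => ?_)
    rw [norm_smul, mul_assoc]
    refine mul_le_mul_of_nonneg_left ?_ (norm_nonneg _)
    rw [inv_mul_eq_div, le_div_iff₀ (Real.sqrt_pos.mpr (hm u)), mul_comm]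
    exact sqrt_mul_norm_le_l2Norm hm φ u

theorem exists_bound_of_l2OpNorm_lt {m : W → ℝ} (hm : ∀ v, 0 < m v)
    (T : (W → 𝕜) →ₗ[𝕜] (W → 𝕜)) {c : ℝ} (hc : l2OpNorm 𝕜 m (tensorId T E) < c) :
    ∃ C : ℝ, 0 ≤ C ∧ C < c ∧ ∀ φ : W → E,
      ∑ v, m v * ‖tensorId T E φ v‖ ^ 2 ≤ C ^ 2 * ∑ v, m v * ‖φ v‖ ^ 2 := by
  obtain ⟨C, ⟨hC0, hC⟩, hCc⟩ := exists_lt_of_csInf_lt (exists_l2Norm_tensorId_le hm T) hc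
  refine ⟨C, hC0, hCc, fun φ => ?_⟩
  rw [← l2Norm_sq hm, ← l2Norm_sq hm, ← mul_pow]
  exact pow_le_pow_left₀ (l2Norm_nonneg _ _) (hC φ) 2

open Classical in
/-- The matrix coefficients of `A (I - M)`. -/
theorem randomWalk_comp_single (G : SimpleGraph W) (m : Sym2 W → ℝ) (u v : W)
    (hv : vertexWeight G m v ≠ 0) :
    (randomWalk G m 𝕜 ∘ₗ (LinearMap.id - constProjection G m 𝕜)) (Pi.single u 1) v =
      (((if G.Adj v u then m s(v, u) / vertexWeight G m v else 0) -
        vertexWeight G m u / totalWeight G m : ℝ) : 𝕜) := by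
  have h1 : randomWalk G m 𝕜 (Pi.single u 1) v =
      ((if G.Adj v u then m s(v, u) / vertexWeight G m v else 0 : ℝ) : 𝕜) := by
    change ∑ w with G.Adj v w, ((m s(v, w) / vertexWeight G m v : ℝ) : 𝕜) *
      (Pi.single u 1 : W → 𝕜) w = _
    by_cases h : G.Adj v u
    · rw [Finset.sum_eq_single u, Pi.single_eq_same, mul_one, if_pos h]
      · intro b _ hb
        rw [Pi.single_eq_of_ne hb, mul_zero]
      · intro hu
        exact (hu (Finset.mem_filter.mpr ⟨Finset.mem_univ _, h⟩)).elim
    · rw [if_neg h, Finset.sum_eq_zero, RCLike.ofReal_zero]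
      intro b hb
      have : b ≠ u := by
        rintro rfl
        exact h (Finset.mem_filter.mp hb).2
      rw [Pi.single_eq_of_ne this, mul_zero]
  have h2 : constProjection G m 𝕜 (Pi.single u 1) =
      fun _ => ((vertexWeight G m u / totalWeight G m : ℝ) : 𝕜) := by
    funext x
    change ((1 / totalWeight G m : ℝ) : 𝕜) *
      ∑ w, (vertexWeight G m w : 𝕜) * (Pi.single u 1 : W → 𝕜) w = _
    rw [Finset.sum_eq_single u, Pi.single_eq_same, mul_one, ← RCLike.ofReal_mul,
      one_div_mul_eq_div]
    · intro b _ hb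
      rw [Pi.single_eq_of_ne hb, mul_zero]
    · exact fun h => (h (Finset.mem_univ _)).elim
  -- The random walk fixes constants, so `A (I - M) = A - M`.
  have h3 : ∀ c : 𝕜, randomWalk G m 𝕜 (fun _ => c) v = c := by
    intro c
    change ∑ w with G.Adj v w, ((m s(v, w) / vertexWeight G m v : ℝ) : 𝕜) * c = c
    rw [← Finset.sum_mul, ← RCLike.ofReal_sum, ← Finset.sum_div]
    change ((vertexWeight G m v / vertexWeight G m v : ℝ) : 𝕜) * c = c
    rw [div_self hv, RCLike.ofReal_one, one_mul]
  rw [LinearMap.comp_apply, LinearMap.sub_apply, LinearMap.id_apply, map_sub, Pi.sub_apply, h1, h2,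
    h3, RCLike.ofReal_sub]

end Bound

namespace PureComplex

variable {V : Type*} [DecidableEq V] {n : ℕ} {X : PureComplex V n}

/-! ### The link of an ordered simplex -/

/-- The face spanned by an ordered simplex. -/
def IsSimplex.toFace {j : ℕ} {t : Fin j → V} (ht : X.IsSimplex t) : X.faces :=
  ⟨Finset.univ.image t, ht.2⟩

/-- A vertex of the link, as a vertex of the complex. -/
def LinkVertex.vertex {τ : X.faces} (v : X.LinkVertex τ) : V := Subtype.val v

theorem LinkVertex.vertex_injective (τ : X.faces) :
    Function.Injective (LinkVertex.vertex : X.LinkVertex τ → V) := Subtype.val_injective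

theorem LinkVertex.vertex_mem {τ : X.faces} (v : X.LinkVertex τ) :
    {v.vertex} ∈ (X.link τ).faces := Subtype.property v

theorem LinkVertex.exists_vertex_eq {τ : X.faces} {v : V} (hv : {v} ∈ (X.link τ).faces) :
    ∃ w : X.LinkVertex τ, w.vertex = v := ⟨⟨v, hv⟩, rfl⟩

/-- The operator `A_τ (I - M_τ) ⊗ id_E` on the link of the face spanned by the tuple `t` has norm at
most `C`, in terms of the weights of tuples. -/
def IsLinkBound (X : PureComplex V n) (𝕜 E : Type*) [RCLike 𝕜] [NormedAddCommGroup E]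
    [NormedSpace 𝕜 E] {l : ℕ} (t : Fin (l + 1) → V) (C : ℝ) : Prop :=
  ∀ f : V → E, (∀ v, ¬ X.IsSimplex (Fin.cons v t : Fin (l + 2) → V) → f v = 0) →
    ∑' v, ENNReal.ofReal (X.tupleWeight (Fin.cons v t : Fin (l + 2) → V) *
      ‖∑ᶠ u, ((X.tupleWeight
          (Fin.cons u (Fin.cons v t : Fin (l + 2) → V) : Fin (l + 3) → V) /
            X.tupleWeight (Fin.cons v t : Fin (l + 2) → V) -
          X.tupleWeight (Fin.cons u t : Fin (l + 2) → V) / X.tupleWeight t : ℝ) : 𝕜) • f u‖ ^ 2) ≤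
    ENNReal.ofReal (C ^ 2) * ∑' v, ENNReal.ofReal
      (X.tupleWeight (Fin.cons v t : Fin (l + 2) → V) * ‖f v‖ ^ 2)

theorem IsLinkBound.mono {𝕜 E : Type*} [RCLike 𝕜] [NormedAddCommGroup E] [NormedSpace 𝕜 E] {l : ℕ}
    {t : Fin (l + 1) → V} {C D : ℝ} (h : X.IsLinkBound 𝕜 E t C) (hC : 0 ≤ C) (hCD : C ≤ D) :
    X.IsLinkBound 𝕜 E t D :=
  fun f hf => (h f hf).trans (by gcongr)

section Link

variable {l : ℕ} {t : Fin (l + 1) → V} (ht : X.IsSimplex t)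

include ht

theorem singleton_mem_link_iff (v : V) :
    {v} ∈ (X.link ht.toFace).faces ↔ X.IsSimplex (Fin.cons v t : Fin (l + 2) → V) := by
  rw [isSimplex_cons_iff ht]
  change ({v} : Finset V).Nonempty ∧ Disjoint (Finset.univ.image t) {v} ∧
    Finset.univ.image t ∪ {v} ∈ X.faces ↔ _
  rw [Finset.disjoint_singleton_right, Finset.union_comm, ← Finset.insert_eq]
  simp

theorem isSimplex_cons_linkVertex (v : X.LinkVertex ht.toFace) :
    X.IsSimplex (Fin.cons v.vertex t : Fin (l + 2) → V) := (singleton_mem_link_iff ht v.vertex).mp v.vertex_mem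

theorem linkGraph_adj_iff (v u : X.LinkVertex ht.toFace) :
    (X.linkGraph ht.toFace).Adj v u ↔
      X.IsSimplex (Fin.cons u.vertex (Fin.cons v.vertex t : Fin (l + 2) → V) : Fin (l + 3) → V) := by
  have hv := isSimplex_cons_linkVertex ht v
  have hu := isSimplex_cons_linkVertex ht u
  rw [isSimplex_cons_iff hv, image_cons]
  have h1 := ((isSimplex_cons_iff ht).mp hv).1
  have h2 := ((isSimplex_cons_iff ht).mp hu).1
  change v ≠ u ∧ ({v.vertex, u.vertex} : Finset V).Nonempty ∧
    Disjoint (Finset.univ.image t) {v.vertex, u.vertex} ∧ Finset.univ.image t ∪ {v.vertex, u.vertex} ∈ X.faces ↔ _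
  have h3 : Finset.univ.image t ∪ {v.vertex, u.vertex} = insert u.vertex (insert v.vertex (Finset.univ.image t)) := by
    ext x
    simp only [Finset.mem_union, Finset.mem_insert, Finset.mem_singleton]
    tauto
  have h4 : Disjoint (Finset.univ.image t) {v.vertex, u.vertex} := by
    rw [Finset.disjoint_insert_right, Finset.disjoint_singleton_right]
    exact ⟨h1, h2⟩
  have h5 : v ≠ u ↔ u.vertex ∉ insert v.vertex (Finset.univ.image t) := by
    rw [Finset.mem_insert, not_or, and_iff_left h2]
    exact ⟨fun h h' => h (LinkVertex.vertex_injective _ h'.symm), fun h h' => h (congrArg _ h'.symm)⟩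
  rw [h3, h5]
  simp [h4]

theorem linkWeight_eq {v u : X.LinkVertex ht.toFace} (h : (X.linkGraph ht.toFace).Adj v u) :
    X.linkWeight ht.toFace s(v, u) =
      X.tupleWeight (Fin.cons u.vertex (Fin.cons v.vertex t : Fin (l + 2) → V) : Fin (l + 3) → V) := by
  rw [tupleWeight_of_isSimplex ((linkGraph_adj_iff ht v u).mp h), image_cons, image_cons]
  change X.weight (Finset.univ.image t ∪ (s(v, u).map LinkVertex.vertex).toFinset) = X.weight _
  congr 1
  ext x
  have h1 : x ∈ (s(v, u).map LinkVertex.vertex).toFinset ↔ x = v.vertex ∨ x = u.vertex := by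
    rw [Sym2.mem_toFinset, Sym2.map_mk, Sym2.mem_iff]
  rw [Finset.mem_union, h1]
  simp only [Finset.mem_insert]
  tauto

theorem finsum_eq_sum_linkVertex {M : Type*} [AddCommMonoid M] (f : V → M)
    (hf : ∀ v, ¬ X.IsSimplex (Fin.cons v t : Fin (l + 2) → V) → f v = 0) :
    ∑ᶠ v, f v = ∑ v : X.LinkVertex ht.toFace, f v.vertex := by
  rw [finsum_eq_sum_of_support_subset f
    (s := Finset.univ.map ⟨_, LinkVertex.vertex_injective ht.toFace⟩), Finset.sum_map]
  · rfl
  · intro v hv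
    have h1 : X.IsSimplex (Fin.cons v t : Fin (l + 2) → V) := by
      by_contra h
      exact hv (hf v h)
    simp only [Finset.coe_map, Finset.coe_univ, Set.image_univ, Set.mem_range]
    exact LinkVertex.exists_vertex_eq ((singleton_mem_link_iff ht v).mpr h1)

/-- The edges of the link at `v` correspond to the cofaces of `vt` of codimension one, so
`finsum_tupleWeight_cons` evaluates the sum of their weights. Applied once more, it gives the total
weight. -/
theorem vertexWeight_link (hl : l + 2 ≤ n) (v : X.LinkVertex ht.toFace) :
    vertexWeight (X.linkGraph ht.toFace) (X.linkWeight ht.toFace) v =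
      X.tupleWeight (Fin.cons v.vertex t : Fin (l + 2) → V) := by
  rw [← finsum_tupleWeight_cons hl, finsum_eq_sum_linkVertex ht, vertexWeight]
  · rw [Finset.sum_filter]
    refine Finset.sum_congr rfl fun u _ => ?_
    split_ifs with h
    · exact linkWeight_eq ht h
    · exact (tupleWeight_of_not_isSimplex fun h' => h ((linkGraph_adj_iff ht v u).mpr h')).symm
  · intro u hu
    refine tupleWeight_of_not_isSimplex fun h => hu ?_
    -- Position `1` of the tuple `(u, v, t)` holds `v`; deleting it leaves `ut`, so `u` would be a
    -- vertex of the link.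
    have := h.removeNth 1
    convert this using 1
    ext i
    refine Fin.cases rfl (fun i => ?_) i
    have h1 : (1 : Fin (l + 3)).succAbove i.succ = i.succ.succ := by
      rw [← Fin.succ_zero_eq_one, Fin.succ_succAbove_succ, Fin.zero_succAbove]
    rw [Fin.removeNth, h1, Fin.cons_succ, Fin.cons_succ, Fin.cons_succ]

theorem totalWeight_link (hl : l + 2 ≤ n) :
    totalWeight (X.linkGraph ht.toFace) (X.linkWeight ht.toFace) = X.tupleWeight t := by
  rw [← finsum_tupleWeight_cons (by omega), finsum_eq_sum_linkVertex ht, totalWeight]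
  · exact Finset.sum_congr rfl fun v _ => vertexWeight_link ht hl v
  · exact fun v hv => tupleWeight_of_not_isSimplex hv

theorem tsum_ofReal_eq_sum_linkVertex (f : V → ℝ) :
    ∑' v, ENNReal.ofReal (X.tupleWeight (Fin.cons v t : Fin (l + 2) → V) * f v ^ 2) =
      ENNReal.ofReal (∑ v : X.LinkVertex ht.toFace,
        X.tupleWeight (Fin.cons v.vertex t : Fin (l + 2) → V) * f v.vertex ^ 2) := by
  rw [ENNReal.ofReal_sum_of_nonneg fun v _ => mul_nonneg (tupleWeight_nonneg _) (sq_nonneg _),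
    ← finsum_eq_sum_linkVertex ht
      (fun v => ENNReal.ofReal (X.tupleWeight (Fin.cons v t : Fin (l + 2) → V) * f v ^ 2))]
  · refine tsum_eq_finsum ((finite_setOf_isSimplex_cons (X := X) t).subset fun v hv => ?_)
    by_contra h
    exact hv (by simp [tupleWeight_of_not_isSimplex h])
  · intro v hv
    simp [tupleWeight_of_not_isSimplex hv]

/-- By the weight identities above, the matrix coefficients of `A_τ (I - M_τ)` are the differences
of quotients of tuple weights in `IsLinkBound`; functions on the link are identified with functions
on `V` vanishing off it. -/
theorem exists_isLinkBound_of_linkNorm_lt {𝕜 : Type*} [RCLike 𝕜] {E : Type*}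
    [NormedAddCommGroup E] [NormedSpace 𝕜 E] (hl : l + 2 ≤ n) {c : ℝ}
    (hc : X.linkNorm 𝕜 E ht.toFace < c) :
    ∃ C : ℝ, 0 ≤ C ∧ C < c ∧ X.IsLinkBound 𝕜 E t C := by
  have hpos : ∀ v, 0 < vertexWeight (X.linkGraph ht.toFace) (X.linkWeight ht.toFace) v := by
    intro v
    rw [vertexWeight_link ht hl]
    exact tupleWeight_pos (isSimplex_cons_linkVertex ht v)
  obtain ⟨C, hC0, hCc, hC⟩ := exists_bound_of_l2OpNorm_lt hpos _ hc
  refine ⟨C, hC0, hCc, fun f hf => ?_⟩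
  rw [tsum_ofReal_eq_sum_linkVertex ht, tsum_ofReal_eq_sum_linkVertex ht,
    ← ENNReal.ofReal_mul (sq_nonneg C)]
  refine ENNReal.ofReal_le_ofReal ?_
  convert hC (fun v => f v.vertex) using 4 with v _ v _
  · rw [vertexWeight_link ht hl]
  · congr 1
    rw [finsum_eq_sum_linkVertex ht]
    · refine Finset.sum_congr rfl fun u _ => ?_
      rw [randomWalk_comp_single _ _ _ _ (hpos v).ne', vertexWeight_link ht hl,
        vertexWeight_link ht hl, totalWeight_link ht hl]
      congr 3
      split_ifs with h
      · rw [linkWeight_eq ht h]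
      · rw [tupleWeight_of_not_isSimplex fun h' => h ((linkGraph_adj_iff ht v u).mpr h'), zero_div]
    · intro u hu
      rw [hf u hu, smul_zero]
  · rw [vertexWeight_link ht hl]

end Link

/-! ### Cochains as functions on tuples of vertices -/

/-- The tuple of vertices of an ordered simplex. -/
def OrderedSimplex.tuple {k : ℕ} (s : X.OrderedSimplex k) : Fin (k + 1) → V := s.1

theorem OrderedSimplex.isSimplex {k : ℕ} (s : X.OrderedSimplex k) : X.IsSimplex s.tuple := s.2

/-- The ordered simplex with a given tuple of vertices. -/
def IsSimplex.ordered {k : ℕ} {t : Fin (k + 1) → V} (ht : X.IsSimplex t) : X.OrderedSimplex k :=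
  ⟨t, ht⟩

theorem IsSimplex.tuple_ordered {k : ℕ} {t : Fin (k + 1) → V} (ht : X.IsSimplex t) :
    ht.ordered.tuple = t := rfl

theorem OrderedSimplex.tuple_face {k : ℕ} (s : X.OrderedSimplex (k + 1)) (i : Fin (k + 2)) :
    (s.face i).tuple = i.removeNth s.tuple := rfl

theorem OrderedSimplex.tuple_perm {k : ℕ} (s : X.OrderedSimplex k)
    (γ : Equiv.Perm (Fin (k + 1))) : (s.perm γ).tuple = s.tuple ∘ γ := rfl

theorem OrderedSimplex.tuple_smul {Γ : Type*} [Group Γ] [MulAction Γ V] [X.SimplicialAction Γ]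
    {k : ℕ} (g : Γ) (s : X.OrderedSimplex k) : (g • s).tuple = g • s.tuple := rfl

theorem isSimplex_comp_perm_iff {k : ℕ} (t : Fin k → V) (γ : Equiv.Perm (Fin k)) :
    X.IsSimplex (t ∘ γ) ↔ X.IsSimplex t :=
  isSimplex_congr (by rw [← Finset.image_image, Finset.image_univ_equiv])

section Extend

variable {E : Type*} [NormedAddCommGroup E]

open Classical in
/-- The extension by zero of a function on ordered simplices to all tuples of vertices. -/
noncomputable def extendZero {k : ℕ} (φ : X.OrderedSimplex k → E) (t : Fin (k + 1) → V) : E :=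
  if h : X.IsSimplex t then φ h.ordered else 0

theorem extendZero_tuple {k : ℕ} (φ : X.OrderedSimplex k → E) (s : X.OrderedSimplex k) :
    extendZero φ s.tuple = φ s := dif_pos s.isSimplex

theorem extendZero_of_isSimplex {k : ℕ} (φ : X.OrderedSimplex k → E) {t : Fin (k + 1) → V}
    (ht : X.IsSimplex t) : extendZero φ t = φ ht.ordered := dif_pos ht

theorem extendZero_of_not_isSimplex {k : ℕ} (φ : X.OrderedSimplex k → E) {t : Fin (k + 1) → V}
    (ht : ¬ X.IsSimplex t) : extendZero φ t = 0 := dif_neg ht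

variable {𝕜 : Type*} [RCLike 𝕜] [NormedSpace 𝕜 E]

variable (𝕜) in
/-- The codifferential `(δφ)(τ) = ∑ v, (m(vτ) / m(τ)) φ(vτ)`. -/
noncomputable def codifferential {l : ℕ} (φ : X.OrderedSimplex (l + 1) → E)
    (t : X.OrderedSimplex l) : E :=
  ∑ᶠ v, ((X.tupleWeight (Fin.cons v t.tuple : Fin (l + 2) → V) /
    X.tupleWeight t.tuple : ℝ) : 𝕜) • extendZero φ (Fin.cons v t.tuple)

variable (𝕜) in
/-- The value of `A_τ (I - M_τ) φ_τ` at the vertex `s i`, where `τ` is the `i`-th face of `s` and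
`φ_τ(v) = φ(vτ)`. -/
noncomputable def linkDefect {l : ℕ} (φ : X.OrderedSimplex (l + 1) → E) (i : Fin (l + 2))
    (s : Fin (l + 2) → V) : E :=
  ∑ᶠ u, ((X.tupleWeight (Fin.cons u s : Fin (l + 3) → V) / X.tupleWeight s -
    X.tupleWeight (Fin.cons u (i.removeNth s) : Fin (l + 2) → V) /
      X.tupleWeight (i.removeNth s) : ℝ) : 𝕜) • extendZero φ (Fin.cons u (i.removeNth s))

theorem finite_support_smul_extendZero {l : ℕ} (φ : X.OrderedSimplex (l + 1) → E)
    (t : Fin (l + 1) → V) (c : V → 𝕜) :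
    Function.HasFiniteSupport fun v => c v • extendZero φ (Fin.cons v t) := by
  refine (finite_setOf_isSimplex_cons (X := X) t).subset fun v hv => ?_
  by_contra h
  exact hv (by simp only [extendZero_of_not_isSimplex φ h, smul_zero])

variable {Γ : Type*} [Group Γ] [MulAction Γ V] [X.SimplicialAction Γ] {π : Γ →* (E ≃ₗᵢ[𝕜] E)}

theorem extendZero_comp_perm {k : ℕ} {φ : X.OrderedSimplex k → E} (hφ : φ ∈ X.cochains π k)
    (t : Fin (k + 1) → V) (γ : Equiv.Perm (Fin (k + 1))) :
    extendZero φ (t ∘ γ) = Equiv.Perm.sign γ • extendZero φ t := by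
  by_cases ht : X.IsSimplex t
  · rw [extendZero_of_isSimplex φ ht, ← hφ.1 γ ht.ordered]
    exact extendZero_of_isSimplex φ ((isSimplex_comp_perm_iff t γ).mpr ht)
  · rw [extendZero_of_not_isSimplex φ ht, smul_zero]
    exact extendZero_of_not_isSimplex φ fun h => ht ((isSimplex_comp_perm_iff t γ).mp h)

theorem map_extendZero {k : ℕ} {φ : X.OrderedSimplex k → E} (hφ : φ ∈ X.cochains π k)
    (g : Γ) (t : Fin (k + 1) → V) : π g (extendZero φ t) = extendZero φ (g • t) := by
  by_cases ht : X.IsSimplex t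
  · rw [extendZero_of_isSimplex φ ht, hφ.2 g]
    exact (extendZero_of_isSimplex φ ((isSimplex_smul_iff g t).mpr ht)).symm
  · rw [extendZero_of_not_isSimplex φ ht, map_zero]
    exact (extendZero_of_not_isSimplex φ fun h => ht ((isSimplex_smul_iff g t).mp h)).symm

theorem norm_extendZero_smul {k : ℕ} {φ : X.OrderedSimplex k → E} (hφ : φ ∈ X.cochains π k)
    (g : Γ) (t : Fin (k + 1) → V) : ‖extendZero φ (g • t)‖ = ‖extendZero φ t‖ := by
  rw [← map_extendZero hφ, LinearIsometryEquiv.norm_map]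

/-- Moving `v` to the front is a cyclic permutation, which changes an alternating function only by a
sign. -/
theorem norm_extendZero_insertNth {k : ℕ} {φ : X.OrderedSimplex k → E}
    (hφ : φ ∈ X.cochains π k) (i : Fin (k + 1)) (v : V) (t : Fin k → V) :
    ‖extendZero φ (i.insertNth v t)‖ = ‖extendZero φ (Fin.cons v t)‖ := by
  have h1 : (i.insertNth v t : Fin (k + 1) → V) =
      (Fin.cons v t : Fin (k + 1) → V) ∘ i.cycleRange := (Fin.cons_comp_cycleRange v t i).symm
  rw [h1, extendZero_comp_perm hφ]
  rcases Int.units_eq_one_or (Equiv.Perm.sign i.cycleRange) with h | h <;> simp [h, Units.smul_def]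

theorem map_finsum_smul_extendZero {l : ℕ} {φ : X.OrderedSimplex (l + 1) → E}
    (hφ : φ ∈ X.cochains π (l + 1)) (g : Γ) (t : Fin (l + 1) → V) (c : V → 𝕜) :
    π g (∑ᶠ v, c v • extendZero φ (Fin.cons v t)) =
      ∑ᶠ v, c (g⁻¹ • v) • extendZero φ (Fin.cons v (g • t)) := by
  rw [map_finsum (π g) (finite_support_smul_extendZero φ t c),
    ← finsum_comp_equiv (MulAction.toPerm g : Equiv.Perm V)
      (f := fun v => c (g⁻¹ • v) • extendZero φ (Fin.cons v (g • t)))]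
  refine finsum_congr fun v => ?_
  rw [map_smul, map_extendZero hφ, smul_cons, MulAction.toPerm_apply, inv_smul_smul]

theorem tupleWeight_cons_inv_smul {k : ℕ} (g : Γ) (v : V) (t : Fin k → V) :
    X.tupleWeight (Fin.cons (g⁻¹ • v) t : Fin (k + 1) → V) =
      X.tupleWeight (Fin.cons v (g • t) : Fin (k + 1) → V) := by
  rw [← tupleWeight_smul g, smul_cons, smul_inv_smul]

theorem map_linkDefect {l : ℕ} {φ : X.OrderedSimplex (l + 1) → E}
    (hφ : φ ∈ X.cochains π (l + 1)) (g : Γ) (i : Fin (l + 2)) (s : Fin (l + 2) → V) :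
    π g (linkDefect 𝕜 φ i s) = linkDefect 𝕜 φ i (g • s) := by
  rw [linkDefect, map_finsum_smul_extendZero hφ, linkDefect]
  simp only [smul_removeNth, tupleWeight_cons_inv_smul, tupleWeight_smul]

theorem norm_linkDefect_smul {l : ℕ} {φ : X.OrderedSimplex (l + 1) → E}
    (hφ : φ ∈ X.cochains π (l + 1)) (g : Γ) (i : Fin (l + 2)) (s : Fin (l + 2) → V) :
    ‖linkDefect 𝕜 φ i (g • s)‖ = ‖linkDefect 𝕜 φ i s‖ := by
  rw [← map_linkDefect hφ, LinearIsometryEquiv.norm_map]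

/-- The pair `(0, γ)` encodes the permutation fixing `0` and acting as `γ` on the other positions.
It has the sign of `γ`, which is why `δφ` is alternating. -/
theorem cons_comp_decomposeFin {k : ℕ} (v : V) (t : Fin (k + 1) → V)
    (γ : Equiv.Perm (Fin (k + 1))) :
    (Fin.cons v (t ∘ γ) : Fin (k + 2) → V) =
      (Fin.cons v t : Fin (k + 2) → V) ∘ Equiv.Perm.decomposeFin.symm (0, γ) := by
  ext i
  refine Fin.cases ?_ (fun i => ?_) i
  · simp
  · simp

theorem codifferential_mem {l : ℕ} {φ : X.OrderedSimplex (l + 1) → E}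
    (hφ : φ ∈ X.cochains π (l + 1)) : codifferential 𝕜 φ ∈ X.cochains π l := by
  refine ⟨fun γ t => ?_, fun g t => ?_⟩
  · rw [codifferential, codifferential, Units.smul_def,
      smul_finsum' _ (finite_support_smul_extendZero _ _ _)]
    refine finsum_congr fun v => ?_
    rw [OrderedSimplex.tuple_perm, cons_comp_decomposeFin, extendZero_comp_perm hφ,
      tupleWeight_congr (s := t.tuple ∘ γ) (t := t.tuple)
        (by rw [← Finset.image_image, Finset.image_univ_equiv]),
      tupleWeight_congr (t := Fin.cons v t.tuple)
        (by rw [← Finset.image_image, Finset.image_univ_equiv]),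
      Equiv.Perm.decomposeFin.symm_sign, if_pos rfl, one_mul, Units.smul_def, smul_comm]
  · rw [codifferential, map_finsum_smul_extendZero hφ, codifferential]
    simp only [OrderedSimplex.tuple_smul, tupleWeight_cons_inv_smul, tupleWeight_smul]

theorem removeNth_succ_cons {k : ℕ} (v : V) (s : Fin (k + 1) → V) (i : Fin (k + 1)) :
    (i.succ.removeNth (Fin.cons v s : Fin (k + 2) → V) : Fin (k + 1) → V) =
      Fin.cons v (i.removeNth s) := by
  ext j
  refine Fin.cases ?_ (fun j => ?_) j
  · simp [Fin.removeNth]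
  · simp [Fin.removeNth]

theorem differentialFun_apply {k : ℕ} (φ : X.OrderedSimplex k → E) (s : X.OrderedSimplex (k + 1)) :
    X.differentialFun (𝕜 := 𝕜) k φ s =
      ∑ i : Fin (k + 2), (-1 : ℤ) ^ (i : ℕ) • extendZero φ (i.removeNth s.tuple) := by
  change ∑ i : Fin (k + 2), (-1 : ℤ) ^ (i : ℕ) • φ (s.face i) = _
  refine Finset.sum_congr rfl fun i _ => ?_
  rw [← OrderedSimplex.tuple_face, extendZero_tuple]

/-- The cocycle condition on the simplex `vs`. -/
theorem extendZero_eq_sum_of_cocycle {l : ℕ} {φ : X.OrderedSimplex (l + 1) → E}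
    (hd : X.differentialFun (𝕜 := 𝕜) (l + 1) φ = 0) (s : Fin (l + 2) → V) (v : V)
    (hv : X.IsSimplex (Fin.cons v s : Fin (l + 3) → V)) :
    extendZero φ s =
      ∑ i : Fin (l + 2), (-1 : ℤ) ^ (i : ℕ) • extendZero φ (Fin.cons v (i.removeNth s)) := by
  have h := congrFun hd hv.ordered
  rw [differentialFun_apply, Fin.sum_univ_succ, hv.tuple_ordered, Fin.removeNth_zero,
    Fin.tail_cons, Pi.zero_apply] at h
  simp only [removeNth_succ_cons, Fin.val_zero, pow_zero, one_smul, Fin.val_succ, pow_succ,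
    mul_neg, mul_one, neg_smul, Finset.sum_neg_distrib] at h
  rwa [add_neg_eq_zero] at h

/-- On cocycles, `I - dδ` is the alternating sum of the operators `A_τ (I - M_τ)` on the links of
the faces. -/
theorem sub_differential_codifferential_eq {l : ℕ} (hl : l + 2 ≤ n)
    {φ : X.OrderedSimplex (l + 1) → E} (hd : X.differentialFun (𝕜 := 𝕜) (l + 1) φ = 0)
    (s : X.OrderedSimplex (l + 1)) :
    φ s - X.differentialFun (𝕜 := 𝕜) l (codifferential 𝕜 φ) s =
      ∑ i : Fin (l + 2), (-1 : ℤ) ^ (i : ℕ) • linkDefect 𝕜 φ i s.tuple := by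
  have hws : X.tupleWeight s.tuple ≠ 0 := (tupleWeight_pos s.isSimplex).ne'
  -- Average the cocycle equations on `vs` over `v`, with the weights `m(vs) / m(s)` of total mass
  -- one.
  have h1 : φ s = ∑ i : Fin (l + 2), (-1 : ℤ) ^ (i : ℕ) •
      ∑ᶠ v, ((X.tupleWeight (Fin.cons v s.tuple : Fin (l + 3) → V) /
        X.tupleWeight s.tuple : ℝ) : 𝕜) • extendZero φ (Fin.cons v (i.removeNth s.tuple)) := by
    calc φ s = ((∑ᶠ v, X.tupleWeight (Fin.cons v s.tuple : Fin (l + 3) → V) /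
          X.tupleWeight s.tuple : ℝ) : 𝕜) • extendZero φ s.tuple := by
          simp only [div_eq_mul_inv]
          rw [← finsum_mul, finsum_tupleWeight_cons hl, mul_inv_cancel₀ hws, RCLike.ofReal_one,
            one_smul, extendZero_tuple]
      _ = ∑ᶠ v, ((X.tupleWeight (Fin.cons v s.tuple : Fin (l + 3) → V) /
          X.tupleWeight s.tuple : ℝ) : 𝕜) • extendZero φ s.tuple := by
          refine (AddMonoidHom.mk' (fun r : ℝ => (r : 𝕜) • extendZero φ s.tuple)
            fun a b => by rw [RCLike.ofReal_add, add_smul]).map_finsum ?_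
          refine (finite_setOf_isSimplex_cons (X := X) s.tuple).subset fun v hv => ?_
          by_contra h
          exact hv (by simp only [tupleWeight_of_not_isSimplex h, zero_div])
      _ = ∑ᶠ v, ∑ i : Fin (l + 2), (-1 : ℤ) ^ (i : ℕ) •
          ((X.tupleWeight (Fin.cons v s.tuple : Fin (l + 3) → V) /
            X.tupleWeight s.tuple : ℝ) : 𝕜) • extendZero φ (Fin.cons v (i.removeNth s.tuple)) := by
          refine finsum_congr fun v => ?_
          by_cases hv : X.IsSimplex (Fin.cons v s.tuple : Fin (l + 3) → V)
          · rw [extendZero_eq_sum_of_cocycle hd s.tuple v hv, Finset.smul_sum]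
            exact Finset.sum_congr rfl fun i _ => smul_comm _ _ _
          · simp [tupleWeight_of_not_isSimplex hv]
      _ = _ := by
          rw [finsum_sum_comm]
          · refine Finset.sum_congr rfl fun i _ => ?_
            rw [smul_finsum' _ (finite_support_smul_extendZero _ _ _)]
          · intro i _
            refine Set.Finite.subset (finite_support_smul_extendZero φ (i.removeNth s.tuple) fun v =>
              ((X.tupleWeight (Fin.cons v s.tuple : Fin (l + 3) → V) /
                X.tupleWeight s.tuple : ℝ) : 𝕜)) fun v hv => ?_
            exact fun h => hv (by simp only at h ⊢; rw [h, smul_zero])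
  -- `dδφ(s)` is the same alternating sum with `m(v s_i) / m(s_i)` in place of `m(vs) / m(s)`; the
  -- difference of these weights is the kernel of `linkDefect`.
  rw [h1, differentialFun_apply, ← Finset.sum_sub_distrib]
  refine Finset.sum_congr rfl fun i _ => ?_
  rw [← smul_sub, ← OrderedSimplex.tuple_face, extendZero_tuple, codifferential, linkDefect,
    ← finsum_sub_distrib (finite_support_smul_extendZero _ _ _)
      (finite_support_smul_extendZero _ _ _)]
  simp only [← sub_smul, ← RCLike.ofReal_sub]
  rfl

end Extend

theorem finite_fiber_removeNth {l : ℕ} (i : Fin (l + 2)) (t : Fin (l + 1) → V) :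
    {s : Fin (l + 2) → V | i.removeNth s = t ∧ X.IsSimplex s}.Finite := by
  refine ((finite_setOf_isSimplex_cons (X := X) t).image
    fun v => (i.insertNth v t : Fin (l + 2) → V)).subset ?_
  rintro s ⟨rfl, hs⟩
  refine ⟨s i, ?_, Fin.insertNth_self_removeNth i s⟩
  refine (isSimplex_congr ?_).mp hs
  rw [image_cons, ← image_insertNth i, Fin.insertNth_self_removeNth]

/-! ### Cutoff functions on simplices -/

section Cutoff

variable {Γ : Type*} [Group Γ] [TopologicalSpace Γ] [IsTopologicalGroup Γ] [LocallyCompactSpace Γ]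
    [T2Space Γ] [MulAction Γ V] [X.SimplicialAction Γ]

theorem ActsCocompactly.exists_finset_tuples (h : X.ActsCocompactly Γ) (l : ℕ) :
    ∃ R : Finset (Fin (l + 1) → V), (∀ t ∈ R, X.IsSimplex t) ∧
      ∀ t : Fin (l + 1) → V, X.IsSimplex t → ∃ g : Γ, g • t ∈ R := by
  classical
  obtain ⟨F, hF, hcov⟩ := h
  refine ⟨(F.biUnion fun τ => Fintype.piFinset fun _ => τ).filter fun t => X.IsSimplex t,
    fun t ht => (Finset.mem_filter.mp ht).2, fun t ht => ?_⟩
  obtain ⟨τ, hτ, g, hg⟩ := hcov _ ht.2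
  refine ⟨g⁻¹, Finset.mem_filter.mpr ⟨Finset.mem_biUnion.mpr ⟨τ, hτ, ?_⟩,
    (isSimplex_smul_iff _ _).mpr ht⟩⟩
  refine Fintype.mem_piFinset.mpr fun i => ?_
  have h1 : t i ∈ τ.image fun v => g • v := by
    rw [← hg]
    exact Finset.mem_image_of_mem _ (Finset.mem_univ _)
  obtain ⟨v, hv, hvt⟩ := Finset.mem_image.mp h1
  rw [Pi.smul_apply, ← hvt, inv_smul_smul]
  exact hv

/-- There is a cutoff function on ordered simplices for which the sums of invariant functions over
simplices of the next dimension do not depend on the choice of the face map. -/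
theorem exists_tuple_cutoff (hΓ : IsUnimodular Γ) (hproper : X.ActsProperly Γ)
    (hcocompact : X.ActsCocompactly Γ) (l : ℕ) :
    ∃ (R : Finset (Fin (l + 1) → V)) (χ : (Fin (l + 1) → V) → ℝ≥0∞),
      (∀ t ∈ R, X.IsSimplex t) ∧ (∀ t, X.IsSimplex t → ∃ g : Γ, g • t ∈ R) ∧
      (∀ t ∉ R, χ t = 0) ∧ (∀ t, χ t ≠ ∞) ∧ (∀ t ∈ R, χ t ≠ 0) ∧
      ∀ F : (Fin (l + 2) → V) → ℝ≥0∞, (∀ (g : Γ) s, F (g • s) = F s) →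
        (∀ s, ¬ X.IsSimplex s → F s = 0) → ∀ i j : Fin (l + 2),
        ∑' s, χ (i.removeNth s) * F s = ∑' s, χ (j.removeNth s) * F s := by
  obtain ⟨R, hR, hcov⟩ := hcocompact.exists_finset_tuples l
  let : TopologicalSpace V := ⊥
  have : DiscreteTopology V := ⟨rfl⟩
  have : ProperSMul Γ V := hproper
  -- The transporter of a tuple is closed and contained in the transporter of its first vertex,
  -- which is compact by properness.
  have hc : ∀ s r : Fin (l + 1) → V, IsCompact {g : Γ | g • s = r} := by
    intro s r
    have h1 : IsCompact ((fun gx : Γ × V => (gx.1 • gx.2, gx.2)) ⁻¹' {(r 0, s 0)}) :=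
      (ProperSMul.isProperMap_smul_pair (G := Γ) (X := V)).isCompact_preimage isCompact_singleton
    have h2 : IsClosed {g : Γ | g • s = r} :=
      (isClosed_discrete ({r} : Set (Fin (l + 1) → V))).preimage
        (continuous_id.smul continuous_const)
    refine (h1.image continuous_fst).of_isClosed_subset h2 fun g hg => ⟨(g, s 0), ?_, rfl⟩
    exact Prod.ext (congrFun hg 0) rfl
  obtain ⟨χ, h1, h2, h3, h4⟩ := hΓ.exists_cutoff hc R
  refine ⟨R, χ, hR, hcov, h1, h2, h3, fun F hF hF0 i j => ?_⟩
  have hs : ∀ s, F s ≠ 0 → X.IsSimplex s := fun s h => not_not.mp fun h' => h (hF0 s h')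
  refine h4 (fun s => (i.removeNth s : Fin (l + 1) → V))
    (fun s => (j.removeNth s : Fin (l + 1) → V)) F (fun _ _ => rfl) (fun _ _ => rfl) hF
    (fun s h => hcov _ ((hs s h).removeNth i)) (fun s h => hcov _ ((hs s h).removeNth j)) ?_ ?_
  · exact fun t => (finite_fiber_removeNth (X := X) i t).subset fun s h => ⟨h.1, hs s h.2⟩
  · exact fun t => (finite_fiber_removeNth (X := X) j t).subset fun s h => ⟨h.1, hs s h.2⟩

end Cutoff

/-! ### The energy estimate -/

section Energy

variable {E : Type*} [NormedAddCommGroup E] {l : ℕ} (χ : (Fin (l + 1) → V) → ℝ≥0∞)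

/-- The square of the weighted `ℓ²` norm of a cochain. -/
noncomputable def energy (φ : X.OrderedSimplex (l + 1) → E) : ℝ≥0∞ :=
  ∑' s : Fin (l + 2) → V, χ ((0 : Fin (l + 2)).removeNth s) *
    ENNReal.ofReal (X.tupleWeight s * ‖extendZero φ s‖ ^ 2)

variable {χ}

theorem energy_ne_top {R : Finset (Fin (l + 1) → V)} (hχ0 : ∀ t ∉ R, χ t = 0)
    (hχtop : ∀ t, χ t ≠ ∞) (φ : X.OrderedSimplex (l + 1) → E) : energy χ φ ≠ ∞ := by
  have hfin : {s : Fin (l + 2) → V | (0 : Fin (l + 2)).removeNth s ∈ R ∧ X.IsSimplex s}.Finite := by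
    refine (R.finite_toSet.biUnion
      fun t _ => finite_fiber_removeNth (X := X) (0 : Fin (l + 2)) t).subset fun s hs => ?_
    exact Set.mem_biUnion hs.1 ⟨rfl, hs.2⟩
  rw [energy, tsum_eq_sum (s := hfin.toFinset)]
  · exact ENNReal.sum_ne_top.mpr fun s _ => ENNReal.mul_ne_top (hχtop _) ENNReal.ofReal_ne_top
  · intro s hs
    rw [Set.Finite.mem_toFinset] at hs
    by_cases h : X.IsSimplex s
    · rw [hχ0 _ fun h' => hs ⟨h', h⟩, zero_mul]
    · rw [tupleWeight_of_not_isSimplex h, zero_mul, ENNReal.ofReal_zero, mul_zero]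

variable {𝕜 : Type*} [RCLike 𝕜] [NormedSpace 𝕜 E] {Γ : Type*} [Group Γ] [MulAction Γ V]
  [X.SimplicialAction Γ] {π : Γ →* (E ≃ₗᵢ[𝕜] E)}

/-- Values of cochains are controlled by the energy. -/
theorem exists_norm_sq_le_energy {R : Finset (Fin (l + 1) → V)} (hχ0 : ∀ t ∉ R, χ t = 0)
    (hχtop : ∀ t, χ t ≠ ∞) (hχ : ∀ t ∈ R, χ t ≠ 0)
    (hcov : ∀ t, X.IsSimplex t → ∃ g : Γ, g • t ∈ R) (s : X.OrderedSimplex (l + 1)) :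
    ∃ K : ℝ, 0 ≤ K ∧ ∀ φ ∈ X.cochains π (l + 1), ‖φ s‖ ^ 2 ≤ K * (energy χ φ).toReal := by
  -- Translate `s` so that its `0`-th face lies in `R`, where `χ` does not vanish. The single energy
  -- term at `g • s` then bounds `‖φ s‖²`, with a constant independent of `φ`.
  obtain ⟨g, hg⟩ := hcov _ (s.isSimplex.removeNth 0)
  set x := (χ (g • (0 : Fin (l + 2)).removeNth s.tuple)).toReal with hx
  have hx0 : 0 < x := ENNReal.toReal_pos (hχ _ hg) (hχtop _)
  have hw := tupleWeight_pos s.isSimplex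
  refine ⟨(x * X.tupleWeight s.tuple)⁻¹, (inv_pos.mpr (mul_pos hx0 hw)).le, fun φ hφ => ?_⟩
  have h1 := ENNReal.le_tsum (f := fun s : Fin (l + 2) → V => χ ((0 : Fin (l + 2)).removeNth s) *
    ENNReal.ofReal (X.tupleWeight s * ‖extendZero φ s‖ ^ 2)) (g • s.tuple)
  simp only [tupleWeight_smul, norm_extendZero_smul hφ, extendZero_tuple, smul_removeNth] at h1
  have h2 := ENNReal.toReal_mono (energy_ne_top hχ0 hχtop φ) h1
  rw [ENNReal.toReal_mul, ENNReal.toReal_ofReal (mul_nonneg hw.le (sq_nonneg _)), ← hx,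
    ← mul_assoc] at h2
  rw [inv_mul_eq_div, le_div_iff₀ (mul_pos hx0 hw), mul_comm]
  exact h2

/-- Deleting the inserted entry recovers `t`, and weights ignore the order of vertices, so the
position `i` disappears and the operator of `IsLinkBound` remains. -/
theorem linkDefect_insertNth (φ : X.OrderedSimplex (l + 1) → E) (i : Fin (l + 2)) (v : V)
    (t : Fin (l + 1) → V) :
    linkDefect 𝕜 φ i (i.insertNth v t : Fin (l + 2) → V) =
      ∑ᶠ u, ((X.tupleWeight (Fin.cons u (Fin.cons v t : Fin (l + 2) → V) : Fin (l + 3) → V) /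
          X.tupleWeight (Fin.cons v t : Fin (l + 2) → V) -
        X.tupleWeight (Fin.cons u t : Fin (l + 2) → V) / X.tupleWeight t : ℝ) : 𝕜) •
          extendZero φ (Fin.cons u t) := by
  rw [linkDefect]
  simp only [Fin.removeNth_insertNth, tupleWeight_cons_insertNth, tupleWeight_insertNth]

theorem tsum_insertNth (i : Fin (l + 2)) (f : (Fin (l + 2) → V) → ℝ≥0∞) :
    ∑' s, f s = ∑' t : Fin (l + 1) → V, ∑' v : V, f (i.insertNth v t) := by
  rw [← (Fin.insertNthEquiv (fun _ => V) i).tsum_eq, ENNReal.tsum_prod', ENNReal.tsum_comm]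
  rfl

/-- Group the simplices by their `i`-th face `t`. The cutoff depends on `t` alone, and each inner
sum is the link inequality for `v ↦ φ(vt)`; faces outside `R` carry no weight. -/
theorem tsum_linkDefect_le {φ : X.OrderedSimplex (l + 1) → E} (hφ : φ ∈ X.cochains π (l + 1))
    {R : Finset (Fin (l + 1) → V)} (hχ0 : ∀ t ∉ R, χ t = 0) {C : ℝ}
    (hC : ∀ t ∈ R, X.IsLinkBound 𝕜 E t C) (i : Fin (l + 2)) :
    ∑' s : Fin (l + 2) → V, χ (i.removeNth s) *
        ENNReal.ofReal (X.tupleWeight s * ‖linkDefect 𝕜 φ i s‖ ^ 2) ≤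
      ENNReal.ofReal (C ^ 2) * ∑' s : Fin (l + 2) → V, χ (i.removeNth s) *
        ENNReal.ofReal (X.tupleWeight s * ‖extendZero φ s‖ ^ 2) := by
  rw [tsum_insertNth i, tsum_insertNth i, ← ENNReal.tsum_mul_left]
  refine ENNReal.tsum_le_tsum fun t => ?_
  simp only [Fin.removeNth_insertNth, linkDefect_insertNth, norm_extendZero_insertNth hφ,
    tupleWeight_insertNth, ENNReal.tsum_mul_left]
  rw [mul_left_comm]
  by_cases ht : t ∈ R
  · gcongr
    exact hC t ht (fun v => extendZero φ (Fin.cons v t))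
      fun v hv => extendZero_of_not_isSimplex φ hv
  · rw [hχ0 t ht, zero_mul, zero_mul]

theorem ofReal_mul_norm_sum_sq_le {w : ℝ} (hw : 0 ≤ w) (N : ℕ) (x : Fin N → E) :
    ENNReal.ofReal (w * ‖∑ i : Fin N, (-1 : ℤ) ^ (i : ℕ) • x i‖ ^ 2) ≤
      N * ∑ i : Fin N, ENNReal.ofReal (w * ‖x i‖ ^ 2) := by
  rw [← ENNReal.ofReal_sum_of_nonneg fun i _ => mul_nonneg hw (sq_nonneg _),
    ← ENNReal.ofReal_natCast, ← ENNReal.ofReal_mul (Nat.cast_nonneg _), ← Finset.mul_sum]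
  refine ENNReal.ofReal_le_ofReal ?_
  rw [mul_left_comm]
  refine mul_le_mul_of_nonneg_left ?_ hw
  have h1 : ‖∑ i : Fin N, (-1 : ℤ) ^ (i : ℕ) • x i‖ ≤ ∑ i : Fin N, ‖x i‖ := by
    refine (norm_sum_le _ _).trans (Finset.sum_le_sum fun i _ => le_of_eq ?_)
    rcases neg_one_pow_eq_or ℤ (i : ℕ) with h | h <;> rw [h] <;> simp
  refine (pow_le_pow_left₀ (norm_nonneg _) h1 2).trans ?_
  simpa using sq_sum_le_card_mul_sum_sq (s := Finset.univ) (f := fun i => ‖x i‖)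

/-- The alternating sum of the link operators is a contraction for the energy. -/
theorem energy_le {φ ψ : X.OrderedSimplex (l + 1) → E} (hφ : φ ∈ X.cochains π (l + 1))
    (hψ : ∀ s, ψ s = ∑ i : Fin (l + 2), (-1 : ℤ) ^ (i : ℕ) • linkDefect 𝕜 φ i s.tuple)
    (htransfer : ∀ F : (Fin (l + 2) → V) → ℝ≥0∞, (∀ (g : Γ) s, F (g • s) = F s) →
        (∀ s, ¬ X.IsSimplex s → F s = 0) → ∀ i j : Fin (l + 2),
        ∑' s, χ (i.removeNth s) * F s = ∑' s, χ (j.removeNth s) * F s) {C : ℝ}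
    (hC : ∀ i : Fin (l + 2), ∑' s : Fin (l + 2) → V, χ (i.removeNth s) *
        ENNReal.ofReal (X.tupleWeight s * ‖linkDefect 𝕜 φ i s‖ ^ 2) ≤
      ENNReal.ofReal (C ^ 2) * ∑' s : Fin (l + 2) → V, χ (i.removeNth s) *
        ENNReal.ofReal (X.tupleWeight s * ‖extendZero φ s‖ ^ 2)) :
    energy χ ψ ≤ ENNReal.ofReal ((((l : ℝ) + 2) * C) ^ 2) * energy χ φ := by
  have hpt : ∀ s : Fin (l + 2) → V,
      ENNReal.ofReal (X.tupleWeight s * ‖extendZero ψ s‖ ^ 2) ≤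
        ((l + 2 : ℕ) : ℝ≥0∞) * ∑ i : Fin (l + 2),
          ENNReal.ofReal (X.tupleWeight s * ‖linkDefect 𝕜 φ i s‖ ^ 2) := by
    intro s
    by_cases hs : X.IsSimplex s
    · rw [extendZero_of_isSimplex ψ hs, hψ]
      exact ofReal_mul_norm_sum_sq_le (tupleWeight_nonneg s) _ _
    · simp [tupleWeight_of_not_isSimplex hs]
  -- Transfer the cutoff from face `0` to face `i`, apply the link bound there, and transfer back.
  -- Both summands are invariant because `π` is isometric.
  have hterm : ∀ i : Fin (l + 2), ∑' s : Fin (l + 2) → V, χ ((0 : Fin (l + 2)).removeNth s) *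
      ENNReal.ofReal (X.tupleWeight s * ‖linkDefect 𝕜 φ i s‖ ^ 2) ≤
        ENNReal.ofReal (C ^ 2) * energy χ φ := by
    intro i
    rw [htransfer _ _ _ 0 i]
    · refine (hC i).trans_eq ?_
      rw [energy, htransfer _ _ _ i 0]
      · exact fun g s => by rw [tupleWeight_smul, norm_extendZero_smul hφ]
      · exact fun s hs => by simp [tupleWeight_of_not_isSimplex hs]
    · exact fun g s => by rw [tupleWeight_smul, norm_linkDefect_smul hφ]
    · exact fun s hs => by simp [tupleWeight_of_not_isSimplex hs]
  calc energy χ ψ ≤ ∑' s : Fin (l + 2) → V, ((l + 2 : ℕ) : ℝ≥0∞) * ∑ i : Fin (l + 2),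
        χ ((0 : Fin (l + 2)).removeNth s) *
          ENNReal.ofReal (X.tupleWeight s * ‖linkDefect 𝕜 φ i s‖ ^ 2) := by
        refine ENNReal.tsum_le_tsum fun s => ?_
        rw [← Finset.mul_sum, mul_left_comm]
        exact mul_le_mul_right (hpt s) _
    _ = ((l + 2 : ℕ) : ℝ≥0∞) * ∑ i : Fin (l + 2), ∑' s : Fin (l + 2) → V,
        χ ((0 : Fin (l + 2)).removeNth s) *
          ENNReal.ofReal (X.tupleWeight s * ‖linkDefect 𝕜 φ i s‖ ^ 2) := by
        rw [ENNReal.tsum_mul_left, Summable.tsum_finsetSum fun _ _ => ENNReal.summable]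
    _ ≤ ((l + 2 : ℕ) : ℝ≥0∞) * ∑ i : Fin (l + 2), ENNReal.ofReal (C ^ 2) * energy χ φ := by
        gcongr with i
        exact hterm i
    -- One factor `l + 2` comes from Cauchy–Schwarz, the other from the number of faces.
    _ = ENNReal.ofReal ((((l : ℝ) + 2) * C) ^ 2) * energy χ φ := by
        rw [Finset.sum_const, Finset.card_univ, Fintype.card_fin, nsmul_eq_mul, mul_pow,
          ENNReal.ofReal_mul (sq_nonneg _), ENNReal.ofReal_pow (p := (l : ℝ) + 2) (by positivity)]
        have : ENNReal.ofReal ((l : ℝ) + 2) = ((l + 2 : ℕ) : ℝ≥0∞) := by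
          rw [← ENNReal.ofReal_natCast]
          push_cast
          rfl
        rw [this]
        ring

end Energy

/-! ### Vanishing of the cohomology -/

section Neumann

variable {E : Type*} [NormedAddCommGroup E] {𝕜 : Type*} [RCLike 𝕜] [NormedSpace 𝕜 E]
  {Γ : Type*} [Group Γ] [MulAction Γ V] [X.SimplicialAction Γ] {π : Γ →* (E ≃ₗᵢ[𝕜] E)}

theorem hasSum_mem_cochains {k : ℕ} {f : ℕ → X.OrderedSimplex k → E}
    (hf : ∀ j, f j ∈ X.cochains π k) {φ : X.OrderedSimplex k → E}
    (h : ∀ s, HasSum (fun j => f j s) (φ s)) : φ ∈ X.cochains π k := by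
  refine ⟨fun γ s => ?_, fun g s => ?_⟩
  · refine (h (s.perm γ)).unique ?_
    simp only [(hf _).1 γ s]
    rcases Int.units_eq_one_or (Equiv.Perm.sign γ) with h1 | h1
    · simpa only [h1, one_smul] using h s
    · simpa only [h1, Units.neg_smul, one_smul] using (h s).neg
  · refine HasSum.unique ?_ (h (g • s))
    simp only [← (hf _).2 g s]
    exact (h s).map (π g) (π g).continuous

theorem hasSum_extendZero {k : ℕ} {f : ℕ → X.OrderedSimplex k → E} {φ : X.OrderedSimplex k → E}
    (h : ∀ s, HasSum (fun j => f j s) (φ s)) (t : Fin (k + 1) → V) :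
    HasSum (fun j => extendZero (f j) t) (extendZero φ t) := by
  by_cases ht : X.IsSimplex t
  · simp only [extendZero_of_isSimplex _ ht]
    exact h _
  · simp only [extendZero_of_not_isSimplex _ ht]
    exact hasSum_zero

/-- The index set is finite and does not depend on `φ`, so `δ` commutes with simplexwise convergent
series. -/
theorem codifferential_eq_sum {l : ℕ} (φ : X.OrderedSimplex (l + 1) → E)
    (t : X.OrderedSimplex l) :
    codifferential 𝕜 φ t = ∑ v ∈ (finite_setOf_isSimplex_cons (X := X) t.tuple).toFinset,
      ((X.tupleWeight (Fin.cons v t.tuple : Fin (l + 2) → V) /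
        X.tupleWeight t.tuple : ℝ) : 𝕜) • extendZero φ (Fin.cons v t.tuple) := by
  refine finsum_eq_sum_of_support_subset _ fun v hv => ?_
  rw [Set.Finite.coe_toFinset]
  by_contra h
  exact hv (by simp only [extendZero_of_not_isSimplex φ h, smul_zero])

theorem hasSum_codifferential {l : ℕ} {f : ℕ → X.OrderedSimplex (l + 1) → E}
    {φ : X.OrderedSimplex (l + 1) → E} (h : ∀ s, HasSum (fun j => f j s) (φ s))
    (t : X.OrderedSimplex l) :
    HasSum (fun j => codifferential 𝕜 (f j) t) (codifferential 𝕜 φ t) := by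
  simp only [codifferential_eq_sum]
  exact hasSum_sum fun v _ => (hasSum_extendZero h _).const_smul _

theorem hasSum_differentialFun {k : ℕ} {f : ℕ → X.OrderedSimplex k → E}
    {φ : X.OrderedSimplex k → E} (h : ∀ s, HasSum (fun j => f j s) (φ s))
    (s : X.OrderedSimplex (k + 1)) :
    HasSum (fun j => X.differentialFun (𝕜 := 𝕜) k (f j) s)
      (X.differentialFun (𝕜 := 𝕜) k φ s) := by
  simp only [differentialFun_apply]
  exact hasSum_sum fun i _ => (hasSum_extendZero h _).const_smul _

theorem differentialFun_differentialFun {k : ℕ} {φ : X.OrderedSimplex k → E}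
    (hφ : φ ∈ X.cochains π k) :
    X.differentialFun (𝕜 := 𝕜) (k + 1) (X.differentialFun (𝕜 := 𝕜) k φ) = 0 := by
  have h := LinearMap.congr_fun (X.d_comp_d π k) (⟨φ, hφ⟩ : X.cochains π k)
  exact congrArg (fun x : X.cochains π (k + 2) => x.1) h

variable (X 𝕜) in
/-- The operator `I - dδ`. -/
noncomputable def residual {l : ℕ} (φ : X.OrderedSimplex (l + 1) → E) :
    X.OrderedSimplex (l + 1) → E :=
  φ - X.differentialFun (𝕜 := 𝕜) l (codifferential 𝕜 φ)

theorem residual_mem {l : ℕ} {φ : X.OrderedSimplex (l + 1) → E}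
    (hφ : φ ∈ X.cochains π (l + 1)) : X.residual 𝕜 φ ∈ X.cochains π (l + 1) :=
  Submodule.sub_mem _ hφ (X.differentialFun_mem π l (codifferential_mem hφ))

theorem differentialFun_residual {l : ℕ} {φ : X.OrderedSimplex (l + 1) → E}
    (hφ : φ ∈ X.cochains π (l + 1)) (hd : X.differentialFun (𝕜 := 𝕜) (l + 1) φ = 0) :
    X.differentialFun (𝕜 := 𝕜) (l + 1) (X.residual 𝕜 φ) = 0 := by
  rw [residual, map_sub, hd, differentialFun_differentialFun (codifferential_mem hφ), sub_zero]

/-- If the iterates of `I - dδ` on a cocycle are summable, then the cocycle is a coboundary. -/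
theorem exists_primitive_of_summable {l : ℕ} {φ : X.OrderedSimplex (l + 1) → E}
    (hmem : ∀ j, (X.residual 𝕜)^[j] φ ∈ X.cochains π (l + 1))
    (hsum : ∀ s, Summable fun j => (X.residual 𝕜)^[j] φ s) :
    ∃ ψ ∈ X.cochains π l, X.differentialFun (𝕜 := 𝕜) l ψ = φ := by
  set Φ : X.OrderedSimplex (l + 1) → E := fun s => ∑' j, (X.residual 𝕜)^[j] φ s with hΦ
  have hhas : ∀ s, HasSum (fun j => (X.residual 𝕜)^[j] φ s) (Φ s) := fun s => (hsum s).hasSum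
  refine ⟨codifferential 𝕜 Φ, codifferential_mem (hasSum_mem_cochains hmem hhas), ?_⟩
  funext s
  have h1 := hasSum_differentialFun (𝕜 := 𝕜) (hasSum_codifferential (𝕜 := 𝕜) hhas) s
  -- Since `dδ = I - (I - dδ)`, applying `dδ` to the series makes it telescope to its first term.
  have h2 : ∀ j, X.differentialFun (𝕜 := 𝕜) l (codifferential 𝕜 ((X.residual 𝕜)^[j] φ)) s =
      (X.residual 𝕜)^[j] φ s - (X.residual 𝕜)^[j + 1] φ s := by
    intro j
    rw [Function.iterate_succ_apply', residual, Pi.sub_apply, sub_sub_cancel]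
  simp only [h2] at h1
  have h3 : HasSum (fun j => (X.residual 𝕜)^[j + 1] φ s) (Φ s - φ s) := by
    have := (hasSum_nat_add_iff' 1).mpr (hhas s)
    simpa using this
  have h4 := (hhas s).sub h3
  rw [sub_sub_cancel] at h4
  exact h1.unique h4

end Neumann

theorem subsingleton_cohomology_succ_iff {E : Type*} [NormedAddCommGroup E] {𝕜 : Type*} [RCLike 𝕜]
    [NormedSpace 𝕜 E] {Γ : Type*} [Group Γ] [MulAction Γ V] [X.SimplicialAction Γ]
    (π : Γ →* (E ≃ₗᵢ[𝕜] E)) (l : ℕ) :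
    Subsingleton (X.Cohomology π (l + 1)) ↔ ∀ φ ∈ X.cochains π (l + 1),
      X.differentialFun (𝕜 := 𝕜) (l + 1) φ = 0 →
        ∃ ψ ∈ X.cochains π l, X.differentialFun (𝕜 := 𝕜) l ψ = φ := by
  rw [Submodule.Quotient.subsingleton_iff, Submodule.submoduleOf_eq_top]
  constructor
  · intro h φ hφ hd
    obtain ⟨ψ, hψ⟩ := h (show (⟨φ, hφ⟩ : X.cochains π (l + 1)) ∈ X.cocycles π (l + 1) from
      Subtype.ext hd)
    exact ⟨ψ.1, ψ.2, congrArg (fun x : X.cochains π (l + 1) => x.1) hψ⟩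
  · intro h φ hφ
    obtain ⟨ψ, hψ, hψφ⟩ := h φ.1 φ.2 (congrArg (fun x : X.cochains π (l + 2) => x.1) hφ)
    exact ⟨(⟨ψ, hψ⟩ : X.cochains π l), Subtype.ext hψφ⟩

/-- On a complete space, a cocycle is a coboundary if the operators `A_τ (I - M_τ) ⊗ id_E` on the
links are small. -/
theorem exists_primitive_of_linkNorm_lt {Γ : Type*} [Group Γ] [TopologicalSpace Γ]
    [IsTopologicalGroup Γ] [LocallyCompactSpace Γ] [T2Space Γ] (hΓ : IsUnimodular Γ)
    [MulAction Γ V] [X.SimplicialAction Γ] (hproper : X.ActsProperly Γ)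
    (hcocompact : X.ActsCocompactly Γ) {𝕜 : Type*} [RCLike 𝕜] {E : Type*} [NormedAddCommGroup E]
    [NormedSpace 𝕜 E] [CompleteSpace E] {l : ℕ} (hl : l + 2 ≤ n)
    (hgap : ∀ τ : X.faces, τ.1.card = l + 1 → X.linkNorm 𝕜 E τ < 1 / ((l : ℝ) + 2))
    {π : Γ →* (E ≃ₗᵢ[𝕜] E)} {φ : X.OrderedSimplex (l + 1) → E} (hφ : φ ∈ X.cochains π (l + 1))
    (hd : X.differentialFun (𝕜 := 𝕜) (l + 1) φ = 0) :
    ∃ ψ ∈ X.cochains π l, X.differentialFun (𝕜 := 𝕜) l ψ = φ := by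
  obtain ⟨R, χ, hR, hcov, hχ0, hχtop, hχ, htransfer⟩ := exists_tuple_cutoff hΓ hproper hcocompact l
  set c : ℝ := 1 / ((l : ℝ) + 2) with hc
  have hc0 : 0 < c := by positivity
  have hex : ∀ t : R, ∃ C : Set.Ico (0 : ℝ) c, X.IsLinkBound 𝕜 E t.1 C.1 := fun t => by
    obtain ⟨C, h1, h2, h3⟩ := exists_isLinkBound_of_linkNorm_lt (hR t.1 t.2) hl
      (hgap _ (hR t.1 t.2).card_image)
    exact ⟨⟨C, h1, h2⟩, h3⟩
  choose D hD using hex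
  -- Choosing bounds in `[0, c)` keeps the common upper bound over the finite set `R` strictly below
  -- `c`; the element `0` covers an empty `R`.
  have : Nonempty (Set.Ico (0 : ℝ) c) := ⟨⟨0, le_rfl, hc0⟩⟩
  obtain ⟨⟨C, hC0, hCc⟩, hCmax⟩ := (Finset.univ.image D).exists_le
  have hC : ∀ t ∈ R, X.IsLinkBound 𝕜 E t C := fun t ht =>
    (hD ⟨t, ht⟩).mono (D ⟨t, ht⟩).2.1
      (hCmax _ (Finset.mem_image_of_mem D (Finset.mem_univ (⟨t, ht⟩ : R))))
  set q : ℝ := ((l : ℝ) + 2) * C with hq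
  have hq0 : 0 ≤ q := by positivity
  have hq1 : q < 1 := by
    rwa [hc, lt_div_iff₀' (by positivity)] at hCc
  -- The cocycle property is carried through the induction because the formula for `I - dδ` holds
  -- only on cocycles.
  have hiter : ∀ j, (X.residual 𝕜)^[j] φ ∈ X.cochains π (l + 1) ∧
      X.differentialFun (𝕜 := 𝕜) (l + 1) ((X.residual 𝕜)^[j] φ) = 0 ∧
      energy χ ((X.residual 𝕜)^[j] φ) ≤ ENNReal.ofReal ((q ^ j) ^ 2) * energy χ φ := by
    intro j
    induction j with
    | zero => exact ⟨hφ, hd, by simp⟩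
    | succ j ih =>
      obtain ⟨h1, h2, h3⟩ := ih
      rw [Function.iterate_succ_apply']
      refine ⟨residual_mem h1, differentialFun_residual h1 h2, ?_⟩
      have h4 : energy χ (X.residual 𝕜 ((X.residual 𝕜)^[j] φ)) ≤
          ENNReal.ofReal (q ^ 2) * energy χ ((X.residual 𝕜)^[j] φ) := by
        exact energy_le h1 (sub_differential_codifferential_eq hl h2) htransfer
          (tsum_linkDefect_le h1 hχ0 hC)
      refine h4.trans ?_
      rw [pow_succ q j, mul_pow (q ^ j), mul_comm ((q ^ j) ^ 2), ENNReal.ofReal_mul (sq_nonneg q), mul_assoc]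
      gcongr
  refine exists_primitive_of_summable (fun j => (hiter j).1) fun s => ?_
  obtain ⟨K, hK0, hK⟩ := exists_norm_sq_le_energy (π := π) hχ0 hχtop hχ hcov s
  -- The energy, a squared norm, decays like `(q ^ j) ^ 2`, so the values at `s` are dominated by a
  -- geometric series of ratio `q`.
  refine Summable.of_norm_bounded (g := fun j => √(K * (energy χ φ).toReal) * q ^ j)
    ((summable_geometric_of_lt_one hq0 hq1).mul_left _) fun j => ?_
  refine le_of_sq_le_sq ?_ (by positivity)
  rw [mul_pow, Real.sq_sqrt (mul_nonneg hK0 ENNReal.toReal_nonneg), mul_assoc]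
  refine (hK _ (hiter j).1).trans (mul_le_mul_of_nonneg_left ?_ hK0)
  have h5 := ENNReal.toReal_mono
    (ENNReal.mul_ne_top ENNReal.ofReal_ne_top (energy_ne_top hχ0 hχtop φ)) (hiter j).2.2
  rwa [ENNReal.toReal_mul, ENNReal.toReal_ofReal (sq_nonneg _), mul_comm] at h5

end PureComplex

end GarlandBanach

theorem theorem4p4
    {V : Type*} [DecidableEq V] {n : ℕ} (X : GarlandBanach.PureComplex V n)
    {Γ : Type*} [Group Γ] [TopologicalSpace Γ] [IsTopologicalGroup Γ] [LocallyCompactSpace Γ]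
    [T2Space Γ] (hΓ : GarlandBanach.IsUnimodular Γ)
    [MulAction Γ V] [X.SimplicialAction Γ]
    (hproper : X.ActsProperly Γ) (hcocompact : X.ActsCocompactly Γ)
    {𝕜 : Type*} [RCLike 𝕜]
    {E : Type*} [NormedAddCommGroup E] [NormedSpace 𝕜 E] [CompleteSpace E]
    (hE : GarlandBanach.IsReflexiveSpace 𝕜 E)
    (k : ℕ) (hk : 1 ≤ k) (hkn : k + 1 ≤ n)
    (hgap : ∀ τ : X.faces, τ.1.card = k → X.linkNorm 𝕜 E τ < 1 / ((k : ℝ) + 1))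
    (π : Γ →* (E ≃ₗᵢ[𝕜] E)) (hπ : ∀ x : E, Continuous fun g : Γ => π g x) :
    Subsingleton (X.Cohomology π k) := by
  obtain ⟨l, rfl⟩ : ∃ l, k = l + 1 := ⟨k - 1, by omega⟩
  rw [GarlandBanach.PureComplex.subsingleton_cohomology_succ_iff]
  intro φ hφ hd
  refine GarlandBanach.PureComplex.exists_primitive_of_linkNorm_lt hΓ hproper hcocompact hkn
    (fun τ hτ => (hgap τ hτ).trans_eq ?_) hφ hd
  push_cast
  ring
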